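/- Let $\mathbb H^n=\{x\in\mathbb R^{n,1}:\langle x,x\rangle=-1,\ x_{n+1}>0\}$ with $\langle x,y\rangle=x_1y_1+\dots+x_ny_n-x_{n+1}y_{n+1}$. For $n=5,6,7,8$ let $P^n=\{x\in\mathbb H^n:\langle x,\nu\rangle\le 0 \text{ for all } \nu\in N_n\}$ be the right-angled polytope whose facets have the following outward unit normals $N_n$ (they correspond to the vertices of the Gosset polytopes $1_{21},2_{21},3_{21},4_{21}$), and colour its facets as follows. * $n=5$: the 16 normals $\frac12(w,1)$, $w\in\{\pm1\}^5$ with an odd number of minus signs. Two distinct facets $w,w'$ have the same colour iff $w_5=w_5'$ and $w_i=-w_i'$ for $i\le 4$ (8 colours). * $n=6$: 27 integral normals in 9 triplets, one for each colour. One triplet is $(-1,0,0,0,0,0;0)$, $(1,1,0,0,0,0;1)$, $(1,0,1,1,1,1;2)$; five more are obtained from it by cyclically permuting the first six entries; the last three are $\{(1,0,1,0,0,0;1),(0,1,0,0,1,0;1),(0,0,0,1,0,1;1)\}$, $\{(0,1,0,1,0,0;1),(0,0,1,0,0,1;1),(1,0,0,0,1,0;1)\}$, $\{(0,0,1,0,1,0;1),(1,0,0,1,0,0;1),(0,1,0,0,0,1;1)\}$.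 * $n=8$: the 240 normals $(\sqrt2\,u,1)$, where $u\in\mathbb R^8=\langle 1,e_1,\dots,e_7\rangle$ is one of $\pm1,\pm e_i$, $\frac12(\pm1\pm e_m\pm e_{m+1}\pm e_{m+3})$, $\frac12(\pm e_{m+2}\pm e_{m+4}\pm e_{m+5}\pm e_{m+6})$, with $m$ modulo $7$. The 15 colours are the hextets: the set $\{\pm1,\pm e_i\}$, and for each $m$ and each parity the 16 vectors of the last two types with that $m$ and with that parity of the number of minus signs. * $n=7$: the 56 normals $(\sqrt2\,w,\frac1{\sqrt2})$, where $w\in\mathbb R^7=\langle e_1,\dots,e_7\rangle$ is one of $\frac12(\pm e_m\pm e_{m+1}\pm e_{m+3})$, $m$ modulo $7$. The 14 colours are given by $m$ and the parity of the number of minus signs. Let $c$ be the number of colours. The manifold $M^n$ is obtained from copies $P_v$ of $P^n$, $v\in\mathbb Z_2^c$, by identifying each facet $F$ of $P_v$ with the same facet of $P_{v+e_j}$ through the identity, where $j$ is the colour of $F$. Let $C$ be the cube complex dual to this tessellation: its vertices are the $v\in\mathbb Z_2^c$, and each facet of colour $j$ gives an edge between $v$ and $v+e_j$. A state $s$ on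 $P^n$ assigns to each facet the status I or O. It orients the edge of $C$ dual to a facet $F$ of colour $j$ from $v$ to $v+e_j$ (where $v_j=0$) if $F$ has status O, and from $v+e_j$ to $v$ if $F$ has status I. Identify each $k$-cube of $C$ with $[0,1]^k$ so that these orientations match those of the axes; the maps $x\mapsto x_1+\dots+x_k\in\mathbb R/\mathbb Z$ on the cubes define a map $C\to S^1=\mathbb R/\mathbb Z$. A diagonal map $f\colon M^n\to S^1$ of $s$ is a map that is homotopic to the composition of a collapse $M^n\to C$ with this map; here a collapse is a continuous map that sends each $P_v$, and each facet of $P_v$, into the part of $C$ dual to it. A cusp of $M^n$ is a connected component $X$ of the preimage of $P^n\cap B$, where $B$ is a closed horoball centred at an ideal vertex of $P^n$ that meets, inside $P^n$, only facets incident to that vertex. It is toric if there is a homeomorphism $X\cong T^{n-1}\times[0,+\infty)$, where $T^{n-1}$ is a flat torus (a product of $n-1$ circles), the second coordinate is the distance from the boundary horosphere, and the first restricts on each $P_v$ to an isometry for the Euclidean metric of the horosphere (to which points are projected along the geodesics towards the ideal vertex). **Proposition.** Let $n\in\{5,6,7,8\}$. For every state $s$ on $P^n$ and every diagonal map $f\colon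 M^n\to S^1$ of $s$ there is a toric cusp $X\cong T^{n-1}\times[0,+\infty)$ of $M^n$ such that the restriction $f|_X$ is homotopic to a constant. -/

import Mathlib

open Topology

noncomputable section

namespace RightAngled

/-! ### Hyperbolic space and right-angled polytopes -/

/-- Minkowski space `ℝ^{n,1}`: a pair (space component, time component). -/
abbrev Minkowski (n : ℕ) : Type := (Fin n → ℝ) × ℝ

/-- The Lorentzian product of signature `(n, 1)`. -/
def lor {n : ℕ} (x y : Minkowski n) : ℝ := (∑ i, x.1 i * y.1 i) - x.2 * y.2

/-- Hyperbolic `n`-space, in the hyperboloid model. -/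
def hyperboloid (n : ℕ) : Set (Minkowski n) := {x | lor x x = -1 ∧ 0 < x.2}

/-- The hyperbolic polytope cut out by the half-spaces `⟨x, ν F⟩ ≤ 0` with outward normals `ν F`. -/
def polytopeOf {n : ℕ} {ι : Type} (ν : ι → Minkowski n) : Set (Minkowski n) :=
  {x | x ∈ hyperboloid n ∧ ∀ F, lor x (ν F) ≤ 0}

/-- A hyperbolic polytope given by the outward unit normals of its finitely many facets, with
a colouring of the facets: incident facets have distinct colours and every colour is used. -/
structure ColouredPolytope (n : ℕ) where
  Facet : Type
  Colour : Type
  [fintypeFacet : Fintype Facet]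
  [fintypeColour : Fintype Colour]
  [decEqColour : DecidableEq Colour]
  normal : Facet → Minkowski n
  normal_unit : ∀ F, lor (normal F) (normal F) = 1
  colour : Facet → Colour
  proper : ∀ F F', F ≠ F' →
    (∃ x ∈ polytopeOf normal, lor x (normal F) = 0 ∧ lor x (normal F') = 0) → colour F ≠ colour F'
  surjective : Function.Surjective colour

attribute [instance] ColouredPolytope.fintypeFacet ColouredPolytope.fintypeColour
  ColouredPolytope.decEqColour

namespace ColouredPolytope

variable {n : ℕ} (P : ColouredPolytope n)

/-- The polytope itself, as a subset of hyperbolic space. -/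
def carrier : Set (Minkowski n) := polytopeOf P.normal

/-- The point `x` of the polytope lies on the facet `F`. -/
def OnFacet (x : P.carrier) (F : P.Facet) : Prop := lor x.1 (P.normal F) = 0

/-- Two distinct facets that meet inside hyperbolic space. -/
def Adjacent (F F' : P.Facet) : Prop := F ≠ F' ∧ ∃ x : P.carrier, P.OnFacet x F ∧ P.OnFacet x F'

/-! ### The manifold obtained by mirroring the polytope -/

/-- The vectors of `ℤ₂^c`, where `c` is the number of colours. -/
abbrev Vec : Type := P.Colour → ZMod 2

/-- The copies `P_v` of the polytope, `v ∈ ℤ₂^c`, are glued along their facets: a facet `F` of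
colour `j` of `P_v` is identified with the same facet of `P_{v + e_j}`. The equivalence relation
generated by this identifies `(x, v)` and `(x, w)` when every colour in which `v` and `w` differ
is the colour of some facet that contains `x`. -/
def tileSetoid : Setoid (P.carrier × P.Vec) where
  r a b := a.1 = b.1 ∧ ∀ j, a.2 j ≠ b.2 j → ∃ F, P.colour F = j ∧ P.OnFacet a.1 F
  iseqv :=
    { refl := fun a => ⟨rfl, fun _ h => absurd rfl h⟩
      symm := fun {a b} h => ⟨h.1.symm, fun j hj => by
        rw [← h.1]; exact h.2 j (Ne.symm hj)⟩
      trans := fun {a b c} h k => ⟨h.1.trans k.1, fun j hj => by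
        by_cases hab : a.2 j = b.2 j
        · rw [h.1]; exact k.2 j (hab ▸ hj)
        · exact h.2 j hab⟩ }

/-- The manifold `M`, tessellated by the `2^c` copies `P_v` of the polytope. -/
def Manifold : Type := Quotient P.tileSetoid

instance : TopologicalSpace P.Manifold :=
  inferInstanceAs (TopologicalSpace (Quotient P.tileSetoid))

/-- The point `x` of the copy `P_v`. -/
def toManifold (x : P.carrier) (v : P.Vec) : P.Manifold := Quotient.mk P.tileSetoid (x, v)

/-! ### The dual cube complex -/

/-- The part of the dual cube complex that lies in one copy `P_v`: the union of the cubes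
`[0, 1/2]^S`, where `S` runs over the sets of pairwise adjacent facets. The origin is the vertex
dual to `P_v`, and the coordinate `y F` is the distance travelled from it along the edge dual
to `F`, whose midpoint is `y F = 1/2`. -/
def dualTile : Set (P.Facet → ℝ) :=
  {y | (∀ F, 0 ≤ y F ∧ y F ≤ 1 / 2) ∧ ∀ F F', F ≠ F' → 0 < y F → 0 < y F' → P.Adjacent F F'}

/-- The parts of the dual cube complex in the copies `P_v` are glued like the copies. -/
def cubeSetoid : Setoid (P.dualTile × P.Vec) where
  r a b := a.1 = b.1 ∧ ∀ j, a.2 j ≠ b.2 j → ∃ F, P.colour F = j ∧ a.1.1 F = 1 / 2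
  iseqv :=
    { refl := fun a => ⟨rfl, fun _ h => absurd rfl h⟩
      symm := fun {a b} h => ⟨h.1.symm, fun j hj => by
        rw [← h.1]; exact h.2 j (Ne.symm hj)⟩
      trans := fun {a b c} h k => ⟨h.1.trans k.1, fun j hj => by
        by_cases hab : a.2 j = b.2 j
        · rw [h.1]; exact k.2 j (hab ▸ hj)
        · exact h.2 j hab⟩ }

/-- The cube complex `C` dual to the tessellation of `M`. Its vertices are the vectors of
`ℤ₂^c`, and each facet `F` of colour `j` gives an edge from `v` to `v + e_j`. -/
def CubeComplex : Type := Quotient P.cubeSetoid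

instance : TopologicalSpace P.CubeComplex :=
  inferInstanceAs (TopologicalSpace (Quotient P.cubeSetoid))

/-- The point `y` of the part of the cube complex around the vertex `v`. -/
def toCubeComplex (y : P.dualTile) (v : P.Vec) : P.CubeComplex := Quotient.mk P.cubeSetoid (y, v)

/-! ### States and diagonal maps -/

/-- The status of a facet. -/
inductive Status : Type
  | I
  | O
  deriving DecidableEq

/-- A state: every facet gets the status `I` (in) or `O` (out). -/
abbrev State : Type := P.Facet → Status

/-- The edge of `C` dual to the facet `F`, seen from its endpoint `v`, is oriented away from `v`
(sign `1`) or towards `v` (sign `-1`). Where `v_j = 0`, with `j` the colour of `F`, it is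
oriented away from `v` exactly if `F` has the status `O`; where `v_j = 1` the same edge is seen
from its other endpoint. -/
def sign (s : P.State) (v : P.Vec) (F : P.Facet) : ℝ :=
  if (s F = Status.O ↔ v (P.colour F) = 0) then 1 else -1

theorem diagonal_compat (s : P.State) (a b : P.dualTile × P.Vec) (h : P.cubeSetoid a b) :
    ((∑ F, P.sign s a.2 F * a.1.1 F : ℝ) : AddCircle (1 : ℝ)) =
      ((∑ F, P.sign s b.2 F * b.1.1 F : ℝ) : AddCircle (1 : ℝ)) := by
  obtain ⟨y, v⟩ := a
  obtain ⟨y', w⟩ := b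
  obtain ⟨h1, h2⟩ := h
  dsimp only at h1 h2 ⊢
  subst h1
  have key : ∀ F, ((P.sign s v F * y.1 F : ℝ) : AddCircle (1 : ℝ)) =
      ((P.sign s w F * y.1 F : ℝ) : AddCircle (1 : ℝ)) := by
    intro F
    by_cases hF : v (P.colour F) = w (P.colour F)
    · simp only [sign, hF]
    · obtain ⟨F', hc, hF'⟩ := h2 _ hF
      by_cases hFF : F' = F
      · subst hFF
        have h12 : ((1 * (1 / 2) : ℝ) : AddCircle (1 : ℝ)) =
            ((-1 * (1 / 2) : ℝ) : AddCircle (1 : ℝ)) := by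
          rw [← sub_eq_zero, ← AddCircle.coe_sub]
          norm_num
        rw [hF']
        simp only [sign]
        split_ifs
        · rfl
        · exact h12
        · exact h12.symm
        · rfl
      · have h0 : y.1 F = 0 := by
          by_contra hne
          have hpos : 0 < y.1 F := lt_of_le_of_ne (y.2.1 F).1 (Ne.symm hne)
          obtain ⟨-, x, hx, hx'⟩ := y.2.2 F' F hFF (by rw [hF']; norm_num) hpos
          exact P.proper F' F hFF ⟨x.1, x.2, hx, hx'⟩ hc
        rw [h0, mul_zero, mul_zero]
  have hsum : ∀ g : P.Facet → ℝ, ((∑ F, g F : ℝ) : AddCircle (1 : ℝ)) =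
      ∑ F, (g F : AddCircle (1 : ℝ)) := fun g =>
    map_sum (QuotientAddGroup.mk' (AddSubgroup.zmultiples (1 : ℝ))) g _
  rw [hsum, hsum]
  exact Finset.sum_congr rfl fun F _ => key F

/-- The diagonal map `C → S¹ = ℝ/ℤ`. On a cube `[0, 1]^k`, with its axes oriented like the edges
of `C`, it is `t ↦ t₁ + ⋯ + t_k`. Here an edge is parametrised by `t = y F` from an endpoint that it
leaves, and by `t = 1 - y F ≡ -y F` from an endpoint that it enters. -/
def diagonal (s : P.State) : C(P.CubeComplex, AddCircle (1 : ℝ)) where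
  toFun := Quotient.lift
    (fun a : P.dualTile × P.Vec => ((∑ F, P.sign s a.2 F * a.1.1 F : ℝ) : AddCircle (1 : ℝ)))
    (P.diagonal_compat s)
  continuous_toFun := by
    refine Continuous.quotient_lift ?_ _
    refine (AddCircle.continuous_mk' 1).comp (continuous_finsetSum _ fun F _ => ?_)
    refine Continuous.mul ?_
      ((continuous_apply F).comp (continuous_subtype_val.comp continuous_fst))
    exact (continuous_of_discreteTopology (f := fun v : P.Vec => P.sign s v F)).comp continuous_snd

/-- A map `r : M → C` that collapses the manifold onto its dual cube complex, compatibly with the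
tessellation: it sends `P_v` to the part of `C` around `v`, and each facet `F` of `P_v` to the dual
`y F = 1/2`. All such maps are homotopic: any two values at the same point can be joined inside
the dual of the smallest face that contains the point. -/
def IsCollapse (r : C(P.Manifold, P.CubeComplex)) : Prop :=
  ∀ (x : P.carrier) (v : P.Vec), ∃ y : P.dualTile,
    r (P.toManifold x v) = P.toCubeComplex y v ∧ ∀ F, P.OnFacet x F → y.1 F = 1 / 2

/-- A diagonal map `f : M → S¹` of the state `s`: up to homotopy, it is the composition of the
collapse of `M` onto the dual cube complex `C` with the diagonal map `C → S¹`. -/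
def IsDiagonalMap (s : P.State) (f : C(P.Manifold, AddCircle (1 : ℝ))) : Prop :=
  ∃ r : C(P.Manifold, P.CubeComplex), P.IsCollapse r ∧ f.Homotopic ((P.diagonal s).comp r)

/-! ### Cusps -/

/-- A future null vector `p` represents an ideal vertex of the polytope, and the horoball
`-⟨x, p⟩ ≤ 1` centred at it is small: inside the polytope it meets only those facets that are
incident to the ideal vertex. -/
def IsCuspVector (p : Minkowski n) : Prop :=
  lor p p = 0 ∧ 0 < p.2 ∧ (∀ F, lor p (P.normal F) ≤ 0) ∧
    ∀ x : P.carrier, -lor x.1 p ≤ 1 → ∀ F, P.OnFacet x F → lor p (P.normal F) = 0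

/-- The part of the manifold that lies above the small horoball of `p`. -/
def aboveHoroball (p : Minkowski n) : Set P.Manifold :=
  {m | ∃ (x : P.carrier) (v : P.Vec), -lor x.1 p ≤ 1 ∧ m = P.toManifold x v}

/-- `X` is a cusp of the manifold, lying above the ideal vertex `p`. -/
def IsCuspAbove (p : Minkowski n) (X : Set P.Manifold) : Prop :=
  P.IsCuspVector p ∧ ∃ m ∈ P.aboveHoroball p, X = connectedComponentIn (P.aboveHoroball p) m

/-- The cusp `X` above `p` is toric: it is homeomorphic to `T^{n-1} × [0, ∞)`, where `T^{n-1}` is a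
product of circles of lengths `a i`, the coordinate in `[0, ∞)` is the hyperbolic distance
`-log (-⟨x, p⟩)` from the boundary horosphere, and the coordinate in `T^{n-1}` is flat: on each
copy `P_v` it preserves the Euclidean metric of the horosphere. The square of the Euclidean distance
between the projections of `x` and `x'` to the horosphere along the geodesics towards
the ideal vertex is `⟨d, d⟩` for `d = x / (-⟨x, p⟩) - x' / (-⟨x', p⟩)`. -/
def IsToric (p : Minkowski n) (X : Set P.Manifold) : Prop :=
  ∃ a : Fin (n - 1) → ℝ, (∀ i, 0 < a i) ∧
    ∃ Φ : X ≃ₜ ((i : Fin (n - 1)) → AddCircle (a i)) × Set.Ici (0 : ℝ),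
      (∀ (x : P.carrier) (v : P.Vec) (h : P.toManifold x v ∈ X),
        ((Φ ⟨P.toManifold x v, h⟩).2 : ℝ) = -Real.log (-lor x.1 p)) ∧
      ∀ (x x' : P.carrier) (v : P.Vec) (h : P.toManifold x v ∈ X) (h' : P.toManifold x' v ∈ X),
        ∑ i, ‖(Φ ⟨P.toManifold x v, h⟩).1 i - (Φ ⟨P.toManifold x' v, h'⟩).1 i‖ ^ 2 =
          lor ((-lor x.1 p)⁻¹ • x.1 - (-lor x'.1 p)⁻¹ • x'.1)
            ((-lor x.1 p)⁻¹ • x.1 - (-lor x'.1 p)⁻¹ • x'.1)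

/-- `X` is a toric cusp of the manifold. -/
def IsToricCusp (X : Set P.Manifold) : Prop := ∃ p, P.IsCuspAbove p X ∧ P.IsToric p X

/-! ### Existence of diagonal maps -/

theorem continuous_lor_left {m : ℕ} (e : Minkowski m) : Continuous fun x : Minkowski m => lor x e := by
  unfold lor
  fun_prop

open Classical in
/-- An explicit collapse of the polytope onto its part of the dual cube complex. -/
def collapseFun (x : P.carrier) (F : P.Facet) : ℝ :=
  1 / 2 * ∏ F' ∈ Finset.univ.filter (fun F' => F' ≠ F ∧ ¬ P.Adjacent F F'),
    max 0 (lor x.1 (P.normal F) - lor x.1 (P.normal F')) /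
      (-lor x.1 (P.normal F) - lor x.1 (P.normal F'))

theorem collapse_denom (x : P.carrier) {F F' : P.Facet} (h : F' ≠ F ∧ ¬ P.Adjacent F F') :
    0 < -lor x.1 (P.normal F) - lor x.1 (P.normal F') := by
  have h1 := x.2.2 F
  have h2 := x.2.2 F'
  by_contra hle
  exact h.2 ⟨h.1.symm, x, by unfold OnFacet; linarith, by unfold OnFacet; linarith⟩

open Classical in
theorem continuous_collapseFun (F : P.Facet) : Continuous fun x => P.collapseFun x F := by
  unfold collapseFun
  refine continuous_const.mul (continuous_finsetProd _ fun F' hF' => ?_)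
  have c1 := (continuous_lor_left (P.normal F)).comp (continuous_subtype_val (p := (· ∈ P.carrier)))
  have c2 := (continuous_lor_left (P.normal F')).comp (continuous_subtype_val (p := (· ∈ P.carrier)))
  refine (continuous_const.max (c1.sub c2)).div (c1.neg.sub c2) fun x => ?_
  exact (P.collapse_denom x (Finset.mem_filter.1 hF').2).ne'

open Classical in
theorem collapseFun_mem (x : P.carrier) : (fun F => P.collapseFun x F) ∈ P.dualTile := by
  have hfac : ∀ F F', F' ≠ F ∧ ¬ P.Adjacent F F' →
      0 ≤ max 0 (lor x.1 (P.normal F) - lor x.1 (P.normal F')) /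
        (-lor x.1 (P.normal F) - lor x.1 (P.normal F')) ∧
      max 0 (lor x.1 (P.normal F) - lor x.1 (P.normal F')) /
        (-lor x.1 (P.normal F) - lor x.1 (P.normal F')) ≤ 1 := by
    intro F F' h
    have hd := P.collapse_denom x h
    refine ⟨div_nonneg (le_max_left _ _) hd.le, (div_le_one hd).2 (max_le hd.le ?_)⟩
    have := x.2.2 F
    linarith
  refine ⟨fun F => ⟨?_, ?_⟩, fun F F' hne h1 h2 => ?_⟩
  · exact mul_nonneg (by norm_num) (Finset.prod_nonneg fun F' h => (hfac F F' (Finset.mem_filter.1 h).2).1)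
  · have : ∏ F' ∈ Finset.univ.filter (fun F' => F' ≠ F ∧ ¬ P.Adjacent F F'),
        max 0 (lor x.1 (P.normal F) - lor x.1 (P.normal F')) /
          (-lor x.1 (P.normal F) - lor x.1 (P.normal F')) ≤ 1 :=
      Finset.prod_le_one (fun F' h => (hfac F F' (Finset.mem_filter.1 h).2).1)
        (fun F' h => (hfac F F' (Finset.mem_filter.1 h).2).2)
    show 1 / 2 * _ ≤ (1 / 2 : ℝ)
    linarith
  · by_contra hadj
    have hsymm : ¬ P.Adjacent F' F := fun ⟨a, y, b, c⟩ => hadj ⟨a.symm, y, c, b⟩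
    have zero : ∀ G G', G' ≠ G → ¬ P.Adjacent G G' →
        lor x.1 (P.normal G) ≤ lor x.1 (P.normal G') → P.collapseFun x G = 0 := by
      intro G G' a b c
      unfold collapseFun
      rw [Finset.prod_eq_zero (i := G') (by simp [a, b]), mul_zero]
      rw [max_eq_left (by linarith), zero_div]
    rcases le_total (lor x.1 (P.normal F)) (lor x.1 (P.normal F')) with h | h
    · exact h1.ne' (zero F F' hne.symm hadj h)
    · exact h2.ne' (zero F' F hne hsymm h)

open Classical in
theorem collapseFun_onFacet (x : P.carrier) (F : P.Facet) (h : P.OnFacet x F) :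
    P.collapseFun x F = 1 / 2 := by
  unfold collapseFun
  rw [Finset.prod_eq_one, mul_one]
  intro F' hF'
  have hd := P.collapse_denom x (Finset.mem_filter.1 hF').2
  unfold OnFacet at h
  rw [h] at hd ⊢
  rw [neg_zero] at hd ⊢
  rw [max_eq_right hd.le, div_self hd.ne']

/-- Collapses exist, so every state has a diagonal map. -/
theorem exists_isDiagonalMap (s : P.State) : ∃ f, P.IsDiagonalMap s f := by
  have hc : Continuous fun a : P.carrier × P.Vec =>
      P.toCubeComplex ⟨fun F => P.collapseFun a.1 F, P.collapseFun_mem a.1⟩ a.2 := by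
    refine continuous_quotient_mk'.comp (Continuous.prodMk ?_ continuous_snd)
    refine Continuous.subtype_mk (continuous_pi fun F => ?_) _
    exact (P.continuous_collapseFun F).comp continuous_fst
  let r : C(P.Manifold, P.CubeComplex) :=
    { toFun := Quotient.lift (fun a : P.carrier × P.Vec =>
          P.toCubeComplex ⟨fun F => P.collapseFun a.1 F, P.collapseFun_mem a.1⟩ a.2) (by
        rintro ⟨x, v⟩ ⟨x', w⟩ ⟨h1, h2⟩
        dsimp only at h1 h2
        subst h1
        refine Quotient.sound ⟨rfl, fun j hj => ?_⟩
        obtain ⟨F, hF, hx⟩ := h2 j hj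
        exact ⟨F, hF, P.collapseFun_onFacet x F hx⟩)
      continuous_toFun := Continuous.quotient_lift hc _ }
  exact ⟨_, r, fun x v => ⟨⟨_, P.collapseFun_mem x⟩, rfl, fun F => P.collapseFun_onFacet x F⟩,
    ContinuousMap.Homotopic.refl _⟩

end ColouredPolytope

/-! ### The coloured polytopes `P⁵, …, P⁸` -/

/-- Two facets whose unit normals have Lorentzian product at most `-1` do not meet. -/
theorem not_meet {n : ℕ} {x e e' : Minkowski n} (hx : x ∈ hyperboloid n) (he : lor e e = 1)
    (he' : lor e' e' = 1) (hee : lor e e' ≤ -1) (ht : e.2 + e'.2 ≠ 0)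
    (h : lor x e = 0) (h' : lor x e' = 0) : False := by
  obtain ⟨hx1, -⟩ := hx
  unfold lor at *
  have cs := Finset.sum_mul_sq_le_sq_mul_sq Finset.univ x.1 (e.1 + e'.1)
  have e1 : ∑ i, x.1 i * (e.1 + e'.1) i = x.2 * (e.2 + e'.2) := by
    simp only [Pi.add_apply, mul_add, Finset.sum_add_distrib]; linarith
  have e2 : ∑ i, (e.1 + e'.1) i ^ 2 =
      (∑ i, e.1 i * e.1 i) + 2 * (∑ i, e.1 i * e'.1 i) + ∑ i, e'.1 i * e'.1 i := by
    simp only [Finset.mul_sum, ← Finset.sum_add_distrib]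
    exact Finset.sum_congr rfl fun i _ => by simp only [Pi.add_apply]; ring
  have e3 : ∑ i, x.1 i ^ 2 = x.2 * x.2 - 1 := by
    simp only [sq]; linarith
  have hw : ∑ i, (e.1 + e'.1) i ^ 2 ≤ (e.2 + e'.2) ^ 2 := by rw [e2]; nlinarith
  have h0 : 0 ≤ ∑ i, x.1 i ^ 2 := Finset.sum_nonneg fun i _ => sq_nonneg _
  have hpos : 0 < (e.2 + e'.2) ^ 2 := by positivity
  rw [e1] at cs
  have := mul_le_mul_of_nonneg_left hw h0
  rw [e3] at this cs
  nlinarith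

/-- The sign `-1` for `true` (a minus sign) and `1` for `false`. -/
def sgn (b : Bool) : ℤ := if b then -1 else 1

/-- The number of minus signs in a string of signs. -/
def minuses {k : ℕ} (σ : Fin k → Bool) : ℕ := ∑ i, if σ i then 1 else 0

/-- The Lorentzian product of two vectors whose space components are multiples of integer vectors. -/
theorem lor_int {n : ℕ} (c t t' : ℝ) (a b : Fin n → ℤ) :
    lor ((fun i => c * (a i : ℝ), t) : Minkowski n) (fun i => c * (b i : ℝ), t') =
      c ^ 2 * ((∑ i, a i * b i : ℤ) : ℝ) - t * t' := by
  unfold lor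
  push_cast
  rw [Finset.mul_sum]
  congr 1
  exact Finset.sum_congr rfl fun i _ => by ring

/-- The strings of five signs with an odd number of minus signs: the vertices `(±1, …, ±1)` of the
Gosset polytope `1₂₁`. -/
abbrev Facet5 : Type := {σ : Fin 5 → Bool // minuses σ % 2 = 1}

theorem facet5_self : ∀ σ : Facet5, ∑ i, sgn (σ.1 i) * sgn (σ.1 i) = 5 := by decide

theorem facet5_dot : ∀ σ τ : Facet5, σ ≠ τ →
    (![xor (σ.1 0) (σ.1 1), xor (σ.1 0) (σ.1 2), xor (σ.1 0) (σ.1 3)] : Fin 3 → Bool) =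
      ![xor (τ.1 0) (τ.1 1), xor (τ.1 0) (τ.1 2), xor (τ.1 0) (τ.1 3)] →
    ∑ i, sgn (σ.1 i) * sgn (τ.1 i) ≤ -3 := by decide +kernel

/-- The sixteen facets of `P⁵`, dual to the vertices `w` of `1₂₁`. The eight colours are the pairs
`{w, w'}` with the same fifth coordinate and the other four coordinates opposite. -/
def P5 : ColouredPolytope 5 where
  Facet := Facet5
  Colour := Fin 3 → Bool
  normal := fun σ => (fun i => 1 / 2 * (sgn (σ.1 i) : ℝ), 1 / 2)
  normal_unit := fun σ => by
    rw [lor_int, facet5_self]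
    norm_num
  colour := fun σ => ![xor (σ.1 0) (σ.1 1), xor (σ.1 0) (σ.1 2), xor (σ.1 0) (σ.1 3)]
  proper := fun F F' hne ⟨x, hx, h, h'⟩ hc => by
    refine not_meet hx.1 (by rw [lor_int, facet5_self]; norm_num) (by rw [lor_int, facet5_self]; norm_num) ?_ ?_ h h'
    · have hd : ((_ : ℤ) : ℝ) ≤ ((-3 : ℤ) : ℝ) := Int.cast_le.2 (facet5_dot F F' hne hc)
      rw [lor_int]
      push_cast at hd ⊢
      linarith
    · norm_num
  surjective := by decide

/-- The vertices of `2₂₁` in `ℝ^{6,1}`: `vec6 c` are the three vertices of the colour `c`. The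
colours `0, …, 5` are the cyclic permutations of the first six entries of the first triplet. -/
def vec6 (c : Fin 9) (k : Fin 3) : (Fin 6 → ℤ) × ℤ :=
  let t : Fin 3 → (Fin 6 → ℤ) × ℤ :=
    ![(![-1, 0, 0, 0, 0, 0], 0), (![1, 1, 0, 0, 0, 0], 1), (![1, 0, 1, 1, 1, 1], 2)]
  let cyc : Fin 6 → (Fin 6 → ℤ) × ℤ := fun s => (fun i => (t k).1 (i - s), (t k).2)
  ![cyc 0, cyc 1, cyc 2, cyc 3, cyc 4, cyc 5,
    ![(![1, 0, 1, 0, 0, 0], 1), (![0, 1, 0, 0, 1, 0], 1), (![0, 0, 0, 1, 0, 1], 1)] k,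
    ![(![0, 1, 0, 1, 0, 0], 1), (![0, 0, 1, 0, 0, 1], 1), (![1, 0, 0, 0, 1, 0], 1)] k,
    ![(![0, 0, 1, 0, 1, 0], 1), (![1, 0, 0, 1, 0, 0], 1), (![0, 1, 0, 0, 0, 1], 1)] k] c

theorem vec6_self : ∀ c k, ∑ i, (vec6 c k).1 i * (vec6 c k).1 i -
    (vec6 c k).2 * (vec6 c k).2 = 1 := by decide +kernel

theorem vec6_dot : ∀ F F' : Fin 9 × Fin 3, F ≠ F' → F.1 = F'.1 →
    ∑ i, (vec6 F.1 F.2).1 i * (vec6 F'.1 F'.2).1 i - (vec6 F.1 F.2).2 * (vec6 F'.1 F'.2).2 ≤ -1 ∧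
      (vec6 F.1 F.2).2 + (vec6 F'.1 F'.2).2 ≠ 0 := by decide +kernel

/-- The polytope `P⁶` with its 27 facets, partitioned into nine triplets. -/
def P6 : ColouredPolytope 6 where
  Facet := Fin 9 × Fin 3
  Colour := Fin 9
  normal := fun F => (fun i => ((vec6 F.1 F.2).1 i : ℝ), ((vec6 F.1 F.2).2 : ℝ))
  normal_unit := fun F => by
    have h := vec6_self F.1 F.2
    unfold lor
    dsimp only
    exact_mod_cast h
  colour := fun F => F.1
  proper := fun F F' hne ⟨x, hx, h, h'⟩ hc => by
    refine not_meet hx.1 (by unfold lor; dsimp only; exact_mod_cast vec6_self F.1 F.2) (by unfold lor; dsimp only; exact_mod_cast vec6_self F'.1 F'.2) ?_ ?_ h h'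
    · have hd := (vec6_dot F F' hne hc).1
      unfold lor
      dsimp only
      exact_mod_cast hd
    · have hd := (vec6_dot F F' hne hc).2
      dsimp only
      exact_mod_cast hd
  surjective := fun c => ⟨(c, 0), rfl⟩

/-- Octonions are vectors of `ℝ⁸`: the coordinate `0` belongs to `1`, and the coordinate `m.succ`
to the imaginary unit `e_m`, with `m` modulo 7. Here `oct4 pos σ` is twice the octonion
`½ (± u₀ ± u₁ ± u₂ ± u₃)`, where `u_k` is the unit of the coordinate `pos k`. -/
def oct4 (pos : Fin 4 → Fin 8) (σ : Fin 4 → Bool) (i : Fin 8) : ℤ :=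
  ∑ k, if pos k = i then sgn (σ k) else 0

/-- The vertices of `4₂₁`, the octonions `±1, ±e_m` and `½ (±1 ± e_n ± e_{n+1} ± e_{n+3})`,
`½ (± e_{n+2} ± e_{n+4} ± e_{n+5} ± e_{n+6})` with `n` modulo 7. -/
abbrev Facet8 : Type := (Fin 8 × Bool) ⊕ (Fin 7 × Bool × (Fin 4 → Bool))

/-- Twice the vertex of `4₂₁`, in coordinates. -/
def vec8 : Facet8 → Fin 8 → ℤ
  | .inl (m, b) => fun i => if m = i then 2 * sgn b else 0
  | .inr (n, true, σ) => oct4 ![0, n.succ, (n + 1).succ, (n + 3).succ] σ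
  | .inr (n, false, σ) => oct4 ![(n + 2).succ, (n + 4).succ, (n + 5).succ, (n + 6).succ] σ

/-- The hextet of a vertex of `4₂₁`: `±1, ±e_m` form one hextet, and the others are given by `n`
and by the parity of the number of minus signs. -/
def hextet : Facet8 → Option (Fin 7 × Fin 2)
  | .inl _ => none
  | .inr (n, _, σ) => some (n, Fin.ofNat 2 (minuses σ))

theorem vec8_self : ∀ F, ∑ i, vec8 F i * vec8 F i = 4 := by decide +kernel

theorem vec8_dot : ∀ F F', F ≠ F' → hextet F = hextet F' → ∑ i, vec8 F i * vec8 F' i ≤ 0 := by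
  decide +kernel

/-- The polytope `P⁸`: the facet dual to the vertex `u` of `4₂₁` has the normal `(√2 u, 1)`. The 240
facets are partitioned into fifteen hextets. -/
def P8 : ColouredPolytope 8 where
  Facet := Facet8
  Colour := Option (Fin 7 × Fin 2)
  normal := fun F => (fun i => √2 / 2 * (vec8 F i : ℝ), 1)
  normal_unit := fun F => by
    rw [lor_int, vec8_self, div_pow, Real.sq_sqrt (by norm_num)]
    norm_num
  colour := hextet
  proper := fun F F' hne ⟨x, hx, h, h'⟩ hc => by
    refine not_meet hx.1 (by rw [lor_int, vec8_self, div_pow, Real.sq_sqrt (by norm_num)]; norm_num) (by rw [lor_int, vec8_self, div_pow, Real.sq_sqrt (by norm_num)]; norm_num) ?_ ?_ h h'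
    · have hd : ((_ : ℤ) : ℝ) ≤ ((0 : ℤ) : ℝ) := Int.cast_le.2 (vec8_dot F F' hne hc)
      rw [lor_int, div_pow, Real.sq_sqrt (by norm_num)]
      push_cast at hd ⊢
      linarith
    · norm_num
  surjective := by decide +kernel

/-- The vertices `½ (1 ± e_n ± e_{n+1} ± e_{n+3})` of `4₂₁` adjacent to `1`: the vertices of `3₂₁`. -/
abbrev Facet7 : Type := Fin 7 × (Fin 3 → Bool)

/-- Twice the imaginary part of such a vertex; the coordinate `m` belongs to `e_m`. -/
def vec7 (F : Facet7) (i : Fin 7) : ℤ :=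
  ∑ k, if ![F.1, F.1 + 1, F.1 + 3] k = i then sgn (F.2 k) else 0

theorem vec7_self : ∀ F, ∑ i, vec7 F i * vec7 F i = 3 := by decide +kernel

theorem vec7_dot : ∀ F F' : Facet7, F ≠ F' →
    ((F.1, Fin.ofNat 2 (minuses F.2)) : Fin 7 × Fin 2) = (F'.1, Fin.ofNat 2 (minuses F'.2)) →
    ∑ i, vec7 F i * vec7 F' i ≤ -1 := by decide +kernel

/-- The polytope `P⁷`, which is the facet of `P⁸` dual to `1`: the facet dual to the vertex with
imaginary part `w` has the normal `(√2 w, √2 / 2)`. The 56 facets are partitioned into fourteen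
quartets, given by `n` and by the parity of the number of minus signs. -/
def P7 : ColouredPolytope 7 where
  Facet := Facet7
  Colour := Fin 7 × Fin 2
  normal := fun F => (fun i => √2 / 2 * (vec7 F i : ℝ), √2 / 2)
  normal_unit := fun F => by
    rw [lor_int, vec7_self, div_pow, div_mul_div_comm, Real.mul_self_sqrt (by norm_num),
      Real.sq_sqrt (by norm_num)]
    norm_num
  colour := fun F => (F.1, Fin.ofNat 2 (minuses F.2))
  proper := fun F F' hne ⟨x, hx, h, h'⟩ hc => by
    refine not_meet hx.1 (by
      rw [lor_int, vec7_self, div_pow, div_mul_div_comm, Real.mul_self_sqrt (by norm_num),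
        Real.sq_sqrt (by norm_num)]
      norm_num) (by
      rw [lor_int, vec7_self, div_pow, div_mul_div_comm, Real.mul_self_sqrt (by norm_num),
        Real.sq_sqrt (by norm_num)]
      norm_num) ?_ ?_ h h'
    · have hd : ((_ : ℤ) : ℝ) ≤ ((-1 : ℤ) : ℝ) := Int.cast_le.2 (vec7_dot F F' hne hc)
      rw [lor_int, div_pow, div_mul_div_comm, Real.mul_self_sqrt (by norm_num),
        Real.sq_sqrt (by norm_num)]
      push_cast at hd ⊢
      linarith
    · have : (0 : ℝ) < √2 := by positivity
      dsimp only
      positivity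
  surjective := by decide +kernel

end RightAngled

end

open Topology

noncomputable section

namespace RightAngled

/-! Near an ideal vertex with cubical link, the polytope is a Euclidean box times a ray, and the `n
- 1` pairs of opposite incident facets are the walls of the box. Gluing unfolds each side of the box
independently into a circle. If the two opposite walls have different colours, the circle consists
of four intervals; if they share a colour, of two. Hence the cusp is a torus times a ray.

The diagonal map along such a circle is read off from the walls crossed. With different colours each
wall is crossed twice, along parallel edges in opposite directions, so the contributions cancel.
With one shared colour the two walls are crossed once each, and the contributions cancel exactly
when the statuses agree. If this holds for every pair that shares a colour (`CuspChart.Balanced`),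
the diagonal map lifts to `ℝ` on the cusp and is nullhomotopic there (`Balanced.liftTerm_eq`,
`Balanced.nullhomotopic`).

For `n = 5, 7, 8` there is an ideal vertex all of whose incident facets have distinct colours, so
every state is balanced at it. For `n = 6` three ideal vertices correspond to the three pairs in one
colour triplet, and this is the only shared colour at each. Among three facets with two possible
statuses two agree, so one of these vertices is balanced (`exists_balanced6`).

The torus coordinates come from comparing two quotient maps with the same fibres out of the same
union of pieces: the gluing map `proj` and the explicit folding `coord` (`proj_eq_iff`). The
combinatorial facts about the vertices are finite checks on integral Gram matrices. -/

/-! ### Lorentzian algebra and estimates on the hyperboloid. -/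

/-- The Lorentzian product as a bilinear form. -/
def lorForm (n : ℕ) : Minkowski n →ₗ[ℝ] Minkowski n →ₗ[ℝ] ℝ :=
  LinearMap.mk₂ ℝ lor
    (fun x y z => by simp only [lor, Prod.fst_add, Prod.snd_add, Pi.add_apply, add_mul,
      Finset.sum_add_distrib]; ring)
    (fun c x y => by simp only [lor, Prod.smul_fst, Prod.smul_snd, Pi.smul_apply, smul_eq_mul,
      mul_sub, Finset.mul_sum, mul_assoc])
    (fun x y z => by simp only [lor, Prod.fst_add, Prod.snd_add, Pi.add_apply, mul_add,
      Finset.sum_add_distrib]; ring)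
    (fun c x y => by
      simp only [lor, Prod.smul_fst, Prod.smul_snd, Pi.smul_apply, smul_eq_mul,
        mul_sub, Finset.mul_sum]
      congr 1
      · exact Finset.sum_congr rfl fun i _ => by ring
      · ring)

variable {n : ℕ}

theorem lor_eq (x y : Minkowski n) : lor x y = lorForm n x y := rfl

theorem lor_comm (x y : Minkowski n) : lor x y = lor y x := by
  unfold lor
  simp only [mul_comm]

theorem lor_add_left (x y z : Minkowski n) : lor (x + y) z = lor x z + lor y z := by
  simp only [lor_eq, map_add, LinearMap.add_apply]

theorem lor_add_right (x y z : Minkowski n) : lor x (y + z) = lor x y + lor x z := by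
  simp only [lor_eq, map_add]

theorem lor_sub_left (x y z : Minkowski n) : lor (x - y) z = lor x z - lor y z := by
  simp only [lor_eq, map_sub, LinearMap.sub_apply]

theorem lor_sub_right (x y z : Minkowski n) : lor x (y - z) = lor x y - lor x z := by
  simp only [lor_eq, map_sub]

theorem lor_smul_left (c : ℝ) (x y : Minkowski n) : lor (c • x) y = c * lor x y := by
  simp only [lor_eq, map_smul, LinearMap.smul_apply, smul_eq_mul]

theorem lor_smul_right (c : ℝ) (x y : Minkowski n) : lor x (c • y) = c * lor x y := by
  simp only [lor_eq, map_smul, smul_eq_mul]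

theorem lor_neg_left (x y : Minkowski n) : lor (-x) y = -lor x y := by
  simp only [lor_eq, map_neg, LinearMap.neg_apply]

theorem lor_sum_left {ι : Type*} (s : Finset ι) (f : ι → Minkowski n) (y : Minkowski n) :
    lor (∑ i ∈ s, f i) y = ∑ i ∈ s, lor (f i) y := by
  simp only [lor_eq, map_sum, LinearMap.sum_apply]

theorem lor_sum_right {ι : Type*} (s : Finset ι) (f : ι → Minkowski n) (y : Minkowski n) :
    lor y (∑ i ∈ s, f i) = ∑ i ∈ s, lor y (f i) := by
  simp only [lor_eq, map_sum]

/-- The reverse Cauchy–Schwarz inequality for future timelike vectors. -/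
theorem le_neg_lor {x q : Minkowski n} (hx : x ∈ hyperboloid n) {c : ℝ}
    (hq : lor q q ≤ -c ^ 2) (hq2 : 0 < q.2) : c ≤ -lor x q := by
  obtain ⟨hx1, hx2⟩ := hx
  unfold lor at *
  have cs := Finset.sum_mul_sq_le_sq_mul_sq Finset.univ x.1 q.1
  simp only [sq] at cs
  set S := ∑ i, x.1 i * q.1 i
  set X := ∑ i, x.1 i * x.1 i
  set Q := ∑ i, q.1 i * q.1 i
  have hX : 0 ≤ X := Finset.sum_nonneg fun i _ => mul_self_nonneg _
  have hQ : 0 ≤ Q := Finset.sum_nonneg fun i _ => mul_self_nonneg _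
  have hSX : S ≤ √X * √Q := by
    rw [← Real.sqrt_mul hX]
    exact Real.le_sqrt_of_sq_le (by nlinarith)
  have h1 := Real.mul_self_sqrt hX
  have h2 := Real.mul_self_sqrt hQ
  have h3 : √X * √Q + c ≤ x.2 * q.2 := by
    refine abs_le_of_sq_le_sq' ?_ (by positivity) |>.2
    have : (x.2 * q.2) ^ 2 = (X + 1) * (q.2 * q.2) := by
      rw [show X + 1 = x.2 * x.2 by linarith]; ring
    have h5 : (X + 1) * (Q + c ^ 2) ≤ (X + 1) * (q.2 * q.2) :=
      mul_le_mul_of_nonneg_left (by linarith) (by linarith)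
    -- The square is the exact difference between `(X + 1) * (Q + c ^ 2)` and `(√X * √Q + c) ^ 2`.
    nlinarith [sq_nonneg (√X * c - √Q)]
  linarith

/-- Cauchy–Schwarz becomes strict here: the space part of `x` is shorter than its time part, while
those of `p` have equal length. -/
theorem lor_null_neg {x p : Minkowski n} (hx : x ∈ hyperboloid n) (hp : lor p p = 0)
    (hp2 : 0 < p.2) : lor x p < 0 := by
  obtain ⟨hx1, hx2⟩ := hx
  unfold lor at *
  have cs := Finset.sum_mul_sq_le_sq_mul_sq Finset.univ x.1 p.1
  simp only [sq] at cs
  set S := ∑ i, x.1 i * p.1 i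
  have h : S < x.2 * p.2 := by
    refine abs_lt_of_sq_lt_sq' ?_ (by positivity) |>.2
    have hX : ∑ i, x.1 i * x.1 i = x.2 * x.2 - 1 := by linarith
    have hP : ∑ i, p.1 i * p.1 i = p.2 * p.2 := by linarith
    rw [hX, hP] at cs
    nlinarith [mul_pos hp2 hp2]
  linarith

/-- A future null vector distinguishes the two sheets: on the lower one its product with `x` would
be positive. -/
theorem mem_hyperboloid_of_lor_neg {x p : Minkowski n} (hx : lor x x = -1) (hp : lor p p = 0)
    (hp2 : 0 < p.2) (h : lor x p < 0) : x ∈ hyperboloid n := by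
  refine ⟨hx, ?_⟩
  by_contra hle
  have h0 : x.2 ≠ 0 := by
    intro h0
    unfold lor at hx
    have : 0 ≤ ∑ i, x.1 i * x.1 i := Finset.sum_nonneg fun i _ => mul_self_nonneg _
    rw [h0] at hx
    linarith
  have hlt : x.2 < 0 := lt_of_le_of_ne (not_lt.1 hle) h0
  have hneg : -x ∈ hyperboloid n := by
    refine ⟨?_, by simpa using hlt⟩
    rw [lor_neg_left, lor_comm, lor_neg_left, hx]
    norm_num
  have := lor_null_neg hneg hp hp2
  rw [lor_neg_left] at this
  linarith

/-- The horoball `-⟨x, p⟩ ≤ 1` lies inside the half-space with normal `e` if `⟨p, e⟩ < -1`. -/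
theorem lor_neg_of_horoball {x p e : Minkowski n} (hx : x ∈ hyperboloid n) (hp : lor p p = 0)
    (hp2 : 0 < p.2) (he : lor e e = 1) (he2 : 0 ≤ e.2) (hpe : lor p e < -1)
    (hxp : -lor x p ≤ 1) : lor x e < 0 := by
  by_contra hge
  -- This `q` is the orthogonal projection of `p` to the hyperplane `e^⊥`, a timelike vector of norm
  -- exactly `-⟨p, e⟩²`. If `⟨x, e⟩ ≥ 0`, the bound gives `-⟨x, p⟩ ≥ -⟨p, e⟩ > 1`.
  have hq := le_neg_lor (q := p + (-lor p e) • e) (c := -lor p e) hx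
    (by
      simp only [lor_add_left, lor_add_right, lor_smul_left, lor_smul_right, hp, he,
        lor_comm e p]
      nlinarith)
    (by
      have : 0 ≤ (-lor p e) * e.2 := mul_nonneg (by linarith) he2
      simp only [Prod.snd_add, Prod.smul_snd, smul_eq_mul]
      linarith)
  rw [lor_add_right, lor_smul_right] at hq
  nlinarith

/-! ### Charts at ideal vertices and their Lorentzian frames. -/

/-- An ideal vertex `p` of a right-angled polytope with a cubical link, together with the pairs
`N i false`, `N i true` of opposite facets that are incident to it. The vector `p` is so
long that the horoball `-⟨x, p⟩ ≤ 1` misses all other facets. -/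
structure CuspChart (P : ColouredPolytope n) where
  p : Minkowski n
  N : Fin (n - 1) → Bool → P.Facet
  width : ℝ
  dim : 1 ≤ n
  null : lor p p = 0
  pos : 0 < p.2
  width_pos : 0 < width
  inc : ∀ i b, lor p (P.normal (N i b)) = 0
  far : ∀ F, (∀ i b, F ≠ N i b) → lor p (P.normal F) < -1
  time : ∀ F, 0 ≤ (P.normal F).2
  orth : ∀ i j, i ≠ j → lor (P.normal (N i false)) (P.normal (N j false)) = 0
  -- Opposite facets are parallel walls on the horospheres about `p`, at distance `width` on the
  -- horosphere `-⟨x, p⟩ = 1`. Orthogonality for the `true` normals follows from this relation.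
  opp : ∀ i, P.normal (N i false) + P.normal (N i true) = width • p
  colour_inj : ∀ i j b b', P.colour (N i b) = P.colour (N j b') → i = j

namespace CuspChart

variable {P : ColouredPolytope n} (C : CuspChart P)

/-- The unit normal of the first facet of each pair. -/
def e (i : Fin (n - 1)) : Minkowski n := P.normal (C.N i false)

theorem lor_e (i j : Fin (n - 1)) : lor (C.e i) (C.e j) = if i = j then 1 else 0 := by
  split_ifs with h
  · rw [h]; exact P.normal_unit _
  · exact C.orth i j h

theorem lor_p_e (i : Fin (n - 1)) : lor C.p (C.e i) = 0 := C.inc i false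

theorem lor_e_p (i : Fin (n - 1)) : lor (C.e i) C.p = 0 := by rw [lor_comm, lor_p_e]

theorem lor_normal_true (x : Minkowski n) (i : Fin (n - 1)) :
    lor x (P.normal (C.N i true)) = C.width * lor x C.p - lor x (C.e i) := by
  have := congrArg (lor x) (C.opp i)
  rw [lor_add_right, lor_smul_right] at this
  unfold e
  linarith

/-- Gram–Schmidt: subtracting the components along the `e i` keeps the product with `p`, since `p`
is orthogonal to them. A multiple of the null vector `p` then corrects the norm. -/
theorem exists_dual : ∃ q : Minkowski n, lor q q = 0 ∧ lor q C.p = -1 ∧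
    ∀ i, lor q (C.e i) = 0 := by
  obtain ⟨r, hr⟩ : ∃ r : Minkowski n, lor r C.p = -1 := by
    refine ⟨(0, C.p.2⁻¹), ?_⟩
    have := C.pos.ne'
    simp [lor, this]
  let r' := r - ∑ i, lor r (C.e i) • C.e i
  have h1 : lor r' C.p = -1 := by
    simp only [r', lor_sub_left, lor_sum_left, lor_smul_left, hr, lor_e_p]
    simp
  have h2 : ∀ i, lor r' (C.e i) = 0 := by
    intro i
    simp only [r', lor_sub_left, lor_sum_left, lor_smul_left, lor_e]
    simp
  -- Adding `a • p` changes the norm by `-2 * a`, because `⟨r', p⟩ = -1` and `p` is null.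
  refine ⟨r' + (lor r' r' / 2) • C.p, ?_, ?_, fun i => ?_⟩
  · simp only [lor_add_left, lor_add_right, lor_smul_left, lor_smul_right, C.null, h1,
      lor_comm C.p r']
    ring
  · rw [lor_add_left, lor_smul_left, h1, C.null]; ring
  · rw [lor_add_left, lor_smul_left, h2, C.lor_p_e]; ring

/-- The null vector dual to `p` and orthogonal to the normals of the incident facets. -/
def q : Minkowski n := C.exists_dual.choose

theorem lor_q_q : lor C.q C.q = 0 := C.exists_dual.choose_spec.1
theorem lor_q_p : lor C.q C.p = -1 := C.exists_dual.choose_spec.2.1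
theorem lor_p_q : lor C.p C.q = -1 := by rw [lor_comm, lor_q_p]
theorem lor_q_e (i) : lor C.q (C.e i) = 0 := C.exists_dual.choose_spec.2.2 i
theorem lor_e_q (i) : lor (C.e i) C.q = 0 := by rw [lor_comm, lor_q_e]

/-- The Lorentzian products with the frame `p`, `q`, `e i`. -/
def frame : Minkowski n →ₗ[ℝ] (ℝ × ℝ) × (Fin (n - 1) → ℝ) :=
  (((lorForm n).flip C.p).prod ((lorForm n).flip C.q)).prod
    (LinearMap.pi fun i => (lorForm n).flip (C.e i))

theorem frame_apply (x : Minkowski n) :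
    C.frame x = ((lor x C.p, lor x C.q), fun i => lor x (C.e i)) := rfl

theorem frame_surjective : Function.Surjective C.frame := by
  rintro ⟨⟨a, b⟩, c⟩
  refine ⟨(-a) • C.q + (-b) • C.p + ∑ i, c i • C.e i, ?_⟩
  rw [frame_apply]
  simp only [lor_add_left, lor_smul_left, lor_sum_left, lor_q_p, lor_q_q, lor_p_q, lor_q_e,
    lor_e_q, lor_e_p, lor_p_e, C.null, lor_e]
  simp

/-- A surjection between spaces of dimension `n + 1 = 2 + (n - 1)`; `dim` excludes `n = 0`, where
the subtraction is truncated. -/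
theorem frame_injective : Function.Injective C.frame := by
  refine (LinearMap.injective_iff_surjective_of_finrank_eq_finrank ?_).2 C.frame_surjective
  have := C.dim
  simp
  omega

/-- The frame coordinates of both sides agree; thus `p^⊥` is spanned by `p` itself and the `e i`. -/
theorem eq_smul_p {z : Minkowski n} (h : lor z C.p = 0) :
    z = (-lor z C.q) • C.p + ∑ i, lor z (C.e i) • C.e i := by
  apply C.frame_injective
  rw [frame_apply, frame_apply]
  simp only [lor_add_left, lor_smul_left, lor_sum_left, lor_p_q, lor_e_q, lor_e_p, lor_p_e,
    C.null, lor_e, h]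
  simp

/-- The metric of the horospheres in coordinates. -/
theorem lor_self_of_lor_p {z : Minkowski n} (h : lor z C.p = 0) :
    lor z z = ∑ i, lor z (C.e i) ^ 2 := by
  -- Pairing the expansion with `z` kills the `p` term, since `z` is orthogonal to `p`.
  have hz := congrArg (lor · z) (C.eq_smul_p h)
  simp only [lor_add_left, lor_smul_left, lor_sum_left, lor_comm C.p z, h, lor_comm (C.e _) z] at hz
  rw [hz]
  simp [sq]

/-- The difference is a multiple `a • p`. As `p` is null, equal norms leave only `2 * a * ⟨y, p⟩ =
0`. -/
theorem eq_of_coords {x y : Minkowski n} (hp : lor x C.p = lor y C.p) (hne : lor y C.p ≠ 0)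
    (he : ∀ i, lor x (C.e i) = lor y (C.e i)) (h : lor x x = lor y y) : x = y := by
  have hz := C.eq_smul_p (z := x - y) (by rw [lor_sub_left, hp, sub_self])
  simp only [lor_sub_left, he, sub_self, zero_smul, Finset.sum_const_zero, add_zero] at hz
  set a := -(lor x C.q - lor y C.q)
  have hx : x = y + a • C.p := by rw [← hz]; abel
  have ha : a = 0 := by
    rw [hx] at h
    simp only [lor_add_left, lor_add_right, lor_smul_left, lor_smul_right, C.null,
      lor_comm C.p y] at h
    have : a * lor y C.p = 0 := by linarith
    exact (mul_eq_zero.1 this).resolve_right hne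
  rw [hx, ha, zero_smul, add_zero]

theorem lor_p_neg {x : Minkowski n} (hx : x ∈ hyperboloid n) : lor x C.p < 0 :=
  lor_null_neg hx C.null C.pos

theorem incident_of_onFacet {x : P.carrier} (hx : -lor x.1 C.p ≤ 1) {F : P.Facet}
    (hF : P.OnFacet x F) : ∃ i b, F = C.N i b := by
  by_contra h
  push Not at h
  exact (lor_neg_of_horoball x.2.1 C.null C.pos (P.normal_unit F) (C.time F) (C.far F h) hx).ne hF

theorem isCuspVector : P.IsCuspVector C.p := by
  refine ⟨C.null, C.pos, fun F => ?_, fun x hx F hF => ?_⟩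
  · by_cases h : ∃ i b, F = C.N i b
    · obtain ⟨i, b, rfl⟩ := h
      exact (C.inc i b).le
    · push Not at h
      linarith [C.far F h]
  · obtain ⟨i, b, rfl⟩ := C.incident_of_onFacet hx hF
    exact C.inc i b

/-! ### Horospherical coordinates. -/

/-- The coordinate of the horosphere in the direction of the `i`-th pair of facets. -/
def u (i : Fin (n - 1)) (x : Minkowski n) : ℝ := lor x (C.e i) / lor x C.p

theorem u_mem (i : Fin (n - 1)) (x : P.carrier) : C.u i x.1 ∈ Set.Icc 0 C.width := by
  have h := C.lor_p_neg x.2.1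
  have h0 := x.2.2 (C.N i false)
  have h1 := x.2.2 (C.N i true)
  rw [lor_normal_true] at h1
  refine ⟨div_nonneg_of_nonpos h0 h.le, ?_⟩
  rw [u, div_le_iff_of_neg h]
  linarith

theorem onFacet_false (i : Fin (n - 1)) (x : P.carrier) :
    P.OnFacet x (C.N i false) ↔ C.u i x.1 = 0 := by
  have h := (C.lor_p_neg x.2.1).ne
  rw [u, div_eq_zero_iff, or_iff_left h]
  rfl

theorem onFacet_true (i : Fin (n - 1)) (x : P.carrier) :
    P.OnFacet x (C.N i true) ↔ C.u i x.1 = C.width := by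
  have h := (C.lor_p_neg x.2.1).ne
  rw [u, div_eq_iff h, ColouredPolytope.OnFacet, lor_normal_true]
  constructor <;> intro h <;> linarith

/-- The point with the horospherical coordinates `u` at the height `-log τ`. -/
def point (τ : ℝ) (u : Fin (n - 1) → ℝ) : Minkowski n :=
  -- `τ` is the value of `-⟨x, p⟩`, and the coefficient of `p` is the one that makes the norm `-1`.
  τ • (C.q - ∑ i, u i • C.e i + ((∑ i, u i ^ 2 + (τ ^ 2)⁻¹) / 2) • C.p)

theorem lor_point_p (τ : ℝ) (u : Fin (n - 1) → ℝ) : lor (C.point τ u) C.p = -τ := by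
  simp only [point, lor_smul_left, lor_add_left, lor_sub_left, lor_sum_left, lor_q_p, lor_e_p,
    C.null]
  simp

theorem lor_point_e (τ : ℝ) (u : Fin (n - 1) → ℝ) (i) :
    lor (C.point τ u) (C.e i) = -(τ * u i) := by
  simp only [point, lor_smul_left, lor_add_left, lor_sub_left, lor_sum_left, lor_q_e, lor_p_e,
    lor_e]
  simp

theorem lor_point_self {τ : ℝ} (hτ : 0 < τ) (u : Fin (n - 1) → ℝ) :
    lor (C.point τ u) (C.point τ u) = -1 := by
  simp only [point, lor_smul_left, lor_smul_right, lor_add_left, lor_add_right, lor_sub_left,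
    lor_sub_right, lor_sum_left, lor_sum_right, lor_q_e, lor_p_e, lor_e_p, lor_e_q, lor_q_q,
    lor_q_p, lor_p_q, C.null, lor_e]
  simp
  field_simp
  rw [← Finset.mul_sum]
  ring

theorem u_point {τ : ℝ} (hτ : 0 < τ) (u : Fin (n - 1) → ℝ) (i) :
    C.u i (C.point τ u) = u i := by
  rw [CuspChart.u, lor_point_e, lor_point_p, neg_div_neg_eq, mul_div_cancel_left₀ _ hτ.ne']

/-- The half-spaces of the incident facets are the inequalities of the box; those of all other
facets contain the whole horoball. -/
theorem point_mem {τ : ℝ} (hτ : 0 < τ) (h1 : τ ≤ 1) {u : Fin (n - 1) → ℝ}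
    (hu : ∀ i, u i ∈ Set.Icc 0 C.width) : C.point τ u ∈ P.carrier := by
  have hH : C.point τ u ∈ hyperboloid n :=
    mem_hyperboloid_of_lor_neg (C.lor_point_self hτ u) C.null C.pos
      (by rw [lor_point_p]; linarith)
  refine ⟨hH, fun F => ?_⟩
  by_cases h : ∃ i b, F = C.N i b
  · obtain ⟨i, b, rfl⟩ := h
    cases b
    · change lor _ (C.e i) ≤ 0
      rw [lor_point_e]
      have := mul_nonneg hτ.le (hu i).1
      linarith
    · rw [lor_normal_true, lor_point_e, lor_point_p]
      have := mul_le_mul_of_nonneg_left (hu i).2 hτ.le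
      linarith
  · push Not at h
    exact (lor_neg_of_horoball hH C.null C.pos (P.normal_unit F) (C.time F) (C.far F h)
      (by rw [lor_point_p]; linarith)).le

theorem lor_eq_u {x : Minkowski n} (hx : x ∈ hyperboloid n) (i) :
    lor x (C.e i) = C.u i x * lor x C.p := by
  rw [u, div_mul_cancel₀ _ (C.lor_p_neg hx).ne]

theorem ext_coords {x y : P.carrier} (hp : lor x.1 C.p = lor y.1 C.p)
    (hu : ∀ i, C.u i x.1 = C.u i y.1) : x = y :=
  Subtype.ext <| C.eq_of_coords hp (C.lor_p_neg y.2.1).ne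
    (fun i => by rw [C.lor_eq_u x.2.1, C.lor_eq_u y.2.1, hp, hu])
    (x.2.1.1.trans y.2.1.1.symm)

/-- The difference of the normalised points is orthogonal to `p`, and its products with the `e i`
are the coordinate differences up to sign. -/
theorem horosphere_metric (x x' : P.carrier) :
    lor ((-lor x.1 C.p)⁻¹ • x.1 - (-lor x'.1 C.p)⁻¹ • x'.1)
      ((-lor x.1 C.p)⁻¹ • x.1 - (-lor x'.1 C.p)⁻¹ • x'.1) =
      ∑ i, (C.u i x.1 - C.u i x'.1) ^ 2 := by
  have h := (C.lor_p_neg x.2.1).ne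
  have h' := (C.lor_p_neg x'.2.1).ne
  rw [C.lor_self_of_lor_p]
  · refine Finset.sum_congr rfl fun i _ => ?_
    simp only [lor_sub_left, lor_smul_left, u]
    field_simp
    ring
  · simp only [lor_sub_left, lor_smul_left]
    field_simp
    ring

theorem continuous_u (i : Fin (n - 1)) : Continuous fun x : P.carrier => C.u i x.1 :=
  ((ColouredPolytope.continuous_lor_left _).comp continuous_subtype_val).div
    ((ColouredPolytope.continuous_lor_left _).comp continuous_subtype_val) fun x => (C.lor_p_neg x.2.1).ne

end CuspChart

/-! ### Folding a circle onto an interval -/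

/-- The signed coordinate `± w`, with the sign `+` for `a = 0`. -/
def signed (a : ZMod 2) (w : ℝ) : ℝ := if a = 0 then w else -w

theorem norm_coe_of_abs_le {L : ℝ} (hL : 0 < L) {w : ℝ} (h : |w| ≤ L) :
    ‖(w : AddCircle (2 * L))‖ = |w| := by
  rw [AddCircle.norm_coe_eq_abs_iff (2 * L) (by positivity),
    abs_of_pos (show (0 : ℝ) < 2 * L by positivity)]
  linarith

/-- The circle is two copies of `[0, L]` glued at both ends: the norm on the circle recovers `w`,
and `w ≡ -w` modulo `2 * L` only at `0` and `L`. -/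
theorem signed_coe_eq_iff {L : ℝ} (hL : 0 < L) {w w' : ℝ} (hw : w ∈ Set.Icc 0 L)
    (hw' : w' ∈ Set.Icc 0 L) (a a' : ZMod 2) :
    (signed a w : AddCircle (2 * L)) = (signed a' w' : AddCircle (2 * L)) ↔
      w = w' ∧ (a ≠ a' → w = 0 ∨ w = L) := by
  have hnorm : ∀ (b : ZMod 2) {z : ℝ}, z ∈ Set.Icc 0 L →
      ‖(signed b z : AddCircle (2 * L))‖ = z := by
    intro b z hz
    have habs : |signed b z| = z := by
      unfold signed
      split_ifs
      · exact abs_of_nonneg hz.1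
      · rw [abs_neg, abs_of_nonneg hz.1]
    rw [norm_coe_of_abs_le hL (by rw [habs]; exact hz.2), habs]
  have hneg : (w : AddCircle (2 * L)) = ((-w : ℝ) : AddCircle (2 * L)) ↔ w = 0 ∨ w = L := by
    rw [← sub_eq_zero, ← AddCircle.coe_sub, AddCircle.coe_eq_zero_iff]
    constructor
    · rintro ⟨k, hk⟩
      rw [zsmul_eq_mul] at hk
      have hk' : (k : ℝ) * L = w := by linarith
      have h0 : (-1 : ℝ) < k := by
        by_contra hlt
        nlinarith [hw.1]
      have h2 : (k : ℝ) < 2 := by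
        by_contra hlt
        nlinarith [hw.2]
      have h0' : -1 < k := by exact_mod_cast h0
      have h2' : k < 2 := by exact_mod_cast h2
      obtain rfl | rfl : k = 0 ∨ k = 1 := by omega
      · left; simpa using hk'.symm
      · right; simpa using hk'.symm
    · rintro (h | h)
      · exact ⟨0, by simp [h]⟩
      · exact ⟨1, by rw [h]; ring⟩
  have hflip : ∀ b b' : ZMod 2, b ≠ b' → ((signed b w : AddCircle (2 * L)) =
      (signed b' w : AddCircle (2 * L)) ↔ w = 0 ∨ w = L) := by
    intro b b' hb
    unfold signed
    split_ifs with h h'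
    · exact absurd (h.trans h'.symm) hb
    · exact hneg
    · rw [eq_comm]; exact hneg
    · exact absurd (by revert b b'; decide) hb
  constructor
  · intro h
    have hww : w = w' := by
      have := congrArg norm h
      rwa [hnorm a hw, hnorm a' hw'] at this
    subst hww
    exact ⟨rfl, fun ha => (hflip a a' ha).1 h⟩
  · rintro ⟨rfl, h⟩
    by_cases ha : a = a'
    · rw [ha]
    · exact (hflip a a' ha).2 (h ha)

/-- The distance from `0` on a circle that is folded onto an interval of length `μ`: twice if
`same` holds, and four times otherwise. -/
def arc (same : Prop) [Decidable same] (μ : ℝ) (b : ZMod 2) (u : ℝ) : ℝ :=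
  if same ∨ b = 0 then u else 2 * μ - u

/-- Half the length of the circle. -/
def halfLength (same : Prop) [Decidable same] (μ : ℝ) : ℝ := if same then μ else 2 * μ

section
variable (same : Prop) [Decidable same] {μ : ℝ}

theorem halfLength_pos (hμ : 0 < μ) : 0 < halfLength same μ := by
  unfold halfLength
  split_ifs <;> linarith

theorem arc_mem {u : ℝ} (hu : u ∈ Set.Icc 0 μ) (b : ZMod 2) :
    arc same μ b u ∈ Set.Icc 0 (halfLength same μ) := by
  obtain ⟨h0, h1⟩ := hu
  unfold arc halfLength
  constructor <;> split_ifs <;> first | linarith | (exfalso; tauto)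

/-- These are the gluing rules of one side of the box: `a` belongs to the wall `u = 0` and `b` to
the wall `u = μ`. If the colours differ, `b` unfolds at `u = μ` to an arc of length `2 * μ`, both of
whose ends are `u = 0`, and there `a` may change. If they agree, `a` may change at both walls and
`b` plays no role. -/
theorem signed_arc_coe_eq_iff (hμ : 0 < μ) {u u' : ℝ} (hu : u ∈ Set.Icc 0 μ)
    (hu' : u' ∈ Set.Icc 0 μ) (a a' b b' : ZMod 2) :
    (signed a (arc same μ b u) : AddCircle (2 * halfLength same μ)) =
        (signed a' (arc same μ b' u') : AddCircle (2 * halfLength same μ)) ↔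
      u = u' ∧ (same → a ≠ a' → u = 0 ∨ u = μ) ∧
        (¬ same → (a ≠ a' → u = 0) ∧ (b ≠ b' → u = μ)) := by
  rw [signed_coe_eq_iff (halfLength_pos same hμ) (arc_mem same hu b) (arc_mem same hu' b')]
  obtain ⟨h0, h1⟩ := hu
  obtain ⟨h0', h1'⟩ := hu'
  by_cases hs : same
  · simp [arc, halfLength, hs]
  · have hab : ∀ b b' : ZMod 2, b ≠ b' ↔ ((b = 0 ∧ b' ≠ 0) ∨ (b ≠ 0 ∧ b' = 0)) := by decide
    simp only [arc, halfLength, hs, false_or, if_false, false_imp_iff, not_false_eq_true,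
      true_imp_iff, true_and, hab b b']
    by_cases hb : b = 0 <;> by_cases hb' : b' = 0 <;> simp only [hb, hb', if_true, if_false,
      not_true_eq_false, not_false_eq_true, ne_eq, and_true, and_false, or_false, false_or,
      false_imp_iff, true_imp_iff]
    · constructor
      · rintro ⟨h, h'⟩
        exact ⟨h, fun k => (h' k).resolve_right (by linarith)⟩
      · rintro ⟨h, h'⟩
        exact ⟨h, fun k => Or.inl (h' k)⟩
    · constructor
      · rintro ⟨h, h'⟩
        exact ⟨by linarith, fun k => (h' k).resolve_right (by linarith), by linarith⟩
      · rintro ⟨h, h', h''⟩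
        exact ⟨by linarith, fun k => Or.inl (h' k)⟩
    · constructor
      · rintro ⟨h, h'⟩
        refine ⟨by linarith, fun k => ?_, by linarith⟩
        rcases h' k with h' | h' <;> linarith
      · rintro ⟨h, h', h''⟩
        exact ⟨by linarith, fun k => Or.inl (by linarith [h' k])⟩
    · constructor
      · rintro ⟨h, h'⟩
        refine ⟨by linarith, fun k => ?_⟩
        rcases h' k with h' | h' <;> linarith
      · rintro ⟨h, h'⟩
        exact ⟨by linarith, fun k => Or.inr (by linarith [h' k])⟩

/-- Folding is an isometry on each interval, and intervals of length `μ` are at most half the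
circle, so the circle distance does not wrap around. -/
theorem norm_signed_arc_sub (hμ : 0 < μ) {u u' : ℝ} (hu : u ∈ Set.Icc 0 μ)
    (hu' : u' ∈ Set.Icc 0 μ) (a b : ZMod 2) :
    ‖(signed a (arc same μ b u) : AddCircle (2 * halfLength same μ)) -
        (signed a (arc same μ b u') : AddCircle (2 * halfLength same μ))‖ ^ 2 = (u - u') ^ 2 := by
  have habs : |signed a (arc same μ b u) - signed a (arc same μ b u')| = |u - u'| := by
    unfold signed arc
    split_ifs
    · rfl
    · rw [abs_sub_comm u u']; congr 1; ring
    · rw [abs_sub_comm u u']; congr 1; ring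
    · congr 1; ring
  have hle : |u - u'| ≤ halfLength same μ := by
    have h1 : |u - u'| ≤ μ := abs_le.2 ⟨by linarith [hu.1, hu'.2], by linarith [hu.2, hu'.1]⟩
    have h2 : μ ≤ halfLength same μ := by
      unfold halfLength
      split_ifs <;> linarith
    exact h1.trans h2
  rw [← AddCircle.coe_sub, norm_coe_of_abs_le (halfLength_pos same hμ) (habs ▸ hle), habs, sq_abs]

theorem exists_signed_arc (hμ : 0 < μ) (θ : AddCircle (2 * halfLength same μ)) :
    ∃ a b : ZMod 2, ∃ u ∈ Set.Icc 0 μ, (same → b = 0) ∧ (signed a (arc same μ b u) : AddCircle _) = θ := by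
  have hL := halfLength_pos same hμ
  obtain ⟨a, w, hw, hθ⟩ : ∃ a : ZMod 2, ∃ w ∈ Set.Icc 0 (halfLength same μ),
      (signed a w : AddCircle (2 * halfLength same μ)) = θ := by
    have : Fact (0 < 2 * halfLength same μ) := ⟨by positivity⟩
    obtain ⟨z, hz, rfl⟩ := AddCircle.eq_coe_Ico θ
    by_cases h : z ≤ halfLength same μ
    · exact ⟨0, z, ⟨hz.1, h⟩, by simp [signed]⟩
    -- On the second half of the circle, `z` is the reflection of `2 * L - z`, with `2 * L` the
    -- period.
    · refine ⟨1, 2 * halfLength same μ - z, ⟨by linarith [hz.2], by linarith⟩, ?_⟩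
      rw [signed, if_neg (by decide), ← sub_eq_zero, ← AddCircle.coe_sub,
        AddCircle.coe_eq_zero_iff]
      exact ⟨-1, by simp⟩
  by_cases hs : same
  · refine ⟨a, 0, w, by simpa [halfLength, hs] using hw, fun _ => rfl, ?_⟩
    simpa [arc] using hθ
  · have hw2 : w ∈ Set.Icc 0 (2 * μ) := by simpa [halfLength, hs] using hw
    by_cases h : w ≤ μ
    · exact ⟨a, 0, w, ⟨hw.1, h⟩, fun _ => rfl, by simpa [arc] using hθ⟩
    · refine ⟨a, 1, 2 * μ - w, ⟨by linarith [hw2.2], by linarith⟩, fun h => absurd h hs, ?_⟩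
      simpa [arc, hs] using hθ

theorem continuous_signed_arc (a b : ZMod 2) : Continuous fun u => signed a (arc same μ b u) := by
  unfold signed arc
  split_ifs <;> fun_prop

end

/-! ### Quotient maps -/

theorem exists_homeomorph_of_isQuotientMap {X Y Z : Type*} [TopologicalSpace X]
    [TopologicalSpace Y] [TopologicalSpace Z] {f : X → Y} {g : X → Z} (hf : IsQuotientMap f)
    (hg : IsQuotientMap g) (h : ∀ a b, f a = f b ↔ g a = g b) :
    ∃ Φ : Y ≃ₜ Z, ∀ a, Φ (f a) = g a := by
  let F : C(Y, Z) := hf.lift (f := ⟨f, hf.continuous⟩) ⟨g, hg.continuous⟩ fun a b hab => (h a b).1 hab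
  let G : C(Z, Y) := hg.lift (f := ⟨g, hg.continuous⟩) ⟨f, hf.continuous⟩ fun a b hab => (h a b).2 hab
  have hF : ∀ a, F (f a) = g a := fun a => DFunLike.congr_fun
    (hf.lift_comp (f := ⟨f, hf.continuous⟩) ⟨g, hg.continuous⟩ fun a b hab => (h a b).1 hab) a
  have hG : ∀ a, G (g a) = f a := fun a => DFunLike.congr_fun
    (hg.lift_comp (f := ⟨g, hg.continuous⟩) ⟨f, hf.continuous⟩ fun a b hab => (h a b).2 hab) a
  refine ⟨⟨⟨F, G, fun y => ?_, fun z => ?_⟩, F.continuous, G.continuous⟩, hF⟩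
  · obtain ⟨a, rfl⟩ := hf.surjective y
    rw [hF, hG]
  · obtain ⟨a, rfl⟩ := hg.surjective z
    rw [hG, hF]

/-- A quotient map restricts well to the full preimage of a closed set: closedness may be tested in
the ambient spaces on both sides. -/
theorem isQuotientMap_restrict_of_isClosed {X Y : Type*} [TopologicalSpace X] [TopologicalSpace Y]
    {f : X → Y} (hf : IsQuotientMap f) {s : Set Y} (hs : IsClosed s) {t : Set X}
    (ht : f ⁻¹' s = t) : IsQuotientMap fun a : t => (⟨f a, ht.ge a.2⟩ : s) := by
  subst ht
  refine isQuotientMap_iff_isClosed.2 ⟨s.restrictPreimage_surjective hf.surjective, fun A =>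
    ⟨fun hA => hA.preimage hf.continuous.restrictPreimage, fun hA => ?_⟩⟩
  rw [hs.isClosedEmbedding_subtypeVal.isClosed_iff_image_isClosed, ← hf.isClosed_preimage]
  have heq : f ⁻¹' (Subtype.val '' A) = Subtype.val '' (s.restrictPreimage f ⁻¹' A) := by
    ext x
    constructor
    · rintro ⟨⟨y, hys⟩, hy, hyx⟩
      obtain rfl : y = f x := hyx
      exact ⟨⟨x, hys⟩, hy, rfl⟩
    · rintro ⟨y, hy, rfl⟩
      exact ⟨_, hy, rfl⟩
  rw [heq]
  exact (hs.preimage hf.continuous).isClosedEmbedding_subtypeVal.isClosedMap _ hA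

/-- The projection of the disjoint union of the copies of the polytope to the manifold. -/
def tileMk {n : ℕ} (P : ColouredPolytope n) (a : P.carrier × P.Vec) : P.Manifold :=
  P.toManifold a.1 a.2

theorem tileMk_eq_iff {n : ℕ} {P : ColouredPolytope n} (a b : P.carrier × P.Vec) :
    tileMk P a = tileMk P b ↔
      a.1 = b.1 ∧ ∀ j, a.2 j ≠ b.2 j → ∃ F, P.colour F = j ∧ P.OnFacet a.1 F :=
  Quotient.eq (r := P.tileSetoid)

theorem isQuotientMap_tileMk {n : ℕ} (P : ColouredPolytope n) : IsQuotientMap (tileMk P) :=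
  isQuotientMap_quot_mk

namespace CuspChart
variable {n : ℕ} {P : ColouredPolytope n} (C : CuspChart P)

/-! ### The cusp and its coordinates -/

/-- The two facets of the `i`-th pair have the same colour. -/
abbrev SameColour (i : Fin (n - 1)) : Prop :=
  P.colour (C.N i false) = P.colour (C.N i true)

/-- The points of the copies of the polytope that lie above the cusp through the copy `P_0`. -/
def domain : Set (P.carrier × P.Vec) :=
  {a | -lor a.1.1 C.p ≤ 1 ∧ ∀ c, (∀ i b, P.colour (C.N i b) ≠ c) → a.2 c = 0}

/-- The cusp above `p` that passes through the copy `P_0`. -/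
def cusp : Set P.Manifold := tileMk P '' C.domain

/-- Inside the horoball the gluing passes only through incident facets, so the entries of `v` at all
other colours are locked. This makes `domain` saturated. -/
theorem vec_eq_of_mk_eq {a b : P.carrier × P.Vec} (ha : -lor a.1.1 C.p ≤ 1)
    (h : tileMk P a = tileMk P b)
    {c : P.Colour} (hc : ∀ i b, P.colour (C.N i b) ≠ c) : a.2 c = b.2 c := by
  by_contra hne
  obtain ⟨F, hF, hx⟩ := ((tileMk_eq_iff a b).1 h).2 c hne
  obtain ⟨i, b, rfl⟩ := C.incident_of_onFacet ha hx
  exact hc i b hF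

theorem preimage_cusp : tileMk P ⁻¹' C.cusp = C.domain := by
  ext a
  constructor
  · rintro ⟨b, hb, hab⟩
    have h1 := ((tileMk_eq_iff b a).1 hab).1
    exact ⟨h1 ▸ hb.1, fun c hc => (C.vec_eq_of_mk_eq hb.1 hab hc).symm.trans (hb.2 c hc)⟩
  · exact fun ha => ⟨a, ha, rfl⟩

theorem isClosed_horoball : IsClosed {a : P.carrier × P.Vec | -lor a.1.1 C.p ≤ 1} :=
  isClosed_le (((ColouredPolytope.continuous_lor_left _).comp
    (continuous_subtype_val.comp continuous_fst)).neg) continuous_const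

theorem isClosed_vec (s : Set P.Vec) : IsClosed {a : P.carrier × P.Vec | a.2 ∈ s} :=
  (isClosed_discrete s).preimage continuous_snd

theorem isClosed_domain : IsClosed C.domain :=
  C.isClosed_horoball.inter
    (isClosed_vec {v : P.Vec | ∀ c, (∀ i b, P.colour (C.N i b) ≠ c) → v c = 0})

theorem isClosed_cusp : IsClosed C.cusp := by
  rw [← (isQuotientMap_tileMk P).isClosed_preimage, C.preimage_cusp]
  exact C.isClosed_domain

/-- The projection to the cusp. -/
def proj (a : C.domain) : C.cusp := ⟨tileMk P a.1, a.1, a.2, rfl⟩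

theorem isQuotientMap_proj : IsQuotientMap C.proj :=
  isQuotientMap_restrict_of_isClosed (isQuotientMap_tileMk P) C.isClosed_cusp C.preimage_cusp

/-- The torus of the cusp. -/
abbrev Torus : Type := (i : Fin (n - 1)) → AddCircle (2 * halfLength (C.SameColour i) C.width)

/-- The coordinates in the torus. -/
def angle (u : Fin (n - 1) → ℝ) (v : P.Vec) : C.Torus := fun i =>
  (signed (v (P.colour (C.N i false)))
    (arc (C.SameColour i) C.width (v (P.colour (C.N i true))) (u i)) : AddCircle _)

/-- The coordinates of the cusp. -/
def coord (a : C.domain) : C.Torus × Set.Ici (0 : ℝ) :=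
  (C.angle (fun i => C.u i a.1.1.1) a.1.2, ⟨-Real.log (-lor a.1.1.1 C.p), by
    have h := C.lor_p_neg a.1.1.2.1
    exact neg_nonneg.2 (Real.log_nonpos (by linarith) a.2.1)⟩)

theorem continuous_angle : Continuous fun a : (Fin (n - 1) → ℝ) × P.Vec => C.angle a.1 a.2 := by
  refine continuous_prod_of_discrete_right.2 fun v => continuous_pi fun i => ?_
  exact (AddCircle.continuous_mk' _).comp
    ((continuous_signed_arc (C.SameColour i) _ _).comp (continuous_apply i))

theorem continuous_coord : Continuous C.coord := by
  refine Continuous.prodMk (C.continuous_angle.comp (Continuous.prodMk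
    (continuous_pi fun i => (C.continuous_u i).comp
      (continuous_fst.comp continuous_subtype_val)) (continuous_snd.comp continuous_subtype_val)))
    (Continuous.subtype_mk ?_ _)
  refine (Continuous.log ?_ fun a => ?_).neg
  · exact ((ColouredPolytope.continuous_lor_left _).comp (continuous_subtype_val.comp
      (continuous_fst.comp continuous_subtype_val))).neg
  · have h := C.lor_p_neg a.1.1.2.1
    exact (neg_pos.2 h).ne'

theorem continuous_point : Continuous fun a : ℝ × (Fin (n - 1) → ℝ) =>
    C.point (Real.exp (-a.1)) a.2 := by
  unfold point
  have h : Continuous fun a : ℝ × (Fin (n - 1) → ℝ) => (Real.exp (-a.1) ^ 2)⁻¹ :=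
    Continuous.inv₀ (by fun_prop) fun a => by positivity
  fun_prop

/-- The coordinates of the points of the horosphere in the copies of the polytope. -/
abbrev Box : Type := Set.pi Set.univ fun _ : Fin (n - 1) => Set.Icc (0 : ℝ) C.width

/-- The copies of the polytope that meet the cusp. -/
abbrev Copies : Type := {v : P.Vec // ∀ c, (∀ i b, P.colour (C.N i b) ≠ c) → v c = 0}

/-- The parametrisation of the copies by box coordinates and height. -/
def param (a : (C.Box × C.Copies) × Set.Ici (0 : ℝ)) : C.domain :=
  ⟨(⟨C.point (Real.exp (-a.2.1)) a.1.1.1,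
      C.point_mem (Real.exp_pos _) (Real.exp_le_one_iff.2 (neg_nonpos.2 a.2.2))
        fun i => a.1.1.2 i trivial⟩, a.1.2.1), by
    refine ⟨?_, a.1.2.2⟩
    change -lor (C.point _ _) C.p ≤ 1
    rw [lor_point_p, neg_neg]
    exact Real.exp_le_one_iff.2 (neg_nonpos.2 a.2.2)⟩

theorem continuous_param : Continuous C.param := by
  refine Continuous.subtype_mk (Continuous.prodMk (Continuous.subtype_mk ?_ _) ?_) _
  · exact C.continuous_point.comp (Continuous.prodMk (by fun_prop) (by fun_prop))
  · fun_prop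

theorem coord_param : C.coord ∘ C.param =
    Prod.map (fun k : C.Box × C.Copies => C.angle k.1.1 k.2.1) id := by
  funext a
  refine Prod.ext ?_ (Subtype.ext ?_)
  · exact congrArg (C.angle · _) (funext fun i => C.u_point (Real.exp_pos _) _ i)
  · change -Real.log (-lor (C.point _ _) C.p) = _
    rw [lor_point_p, neg_neg, Real.log_exp, neg_neg]
    rfl

theorem exists_copy (a b : Fin (n - 1) → ZMod 2) (hb : ∀ i, C.SameColour i → b i = 0) :
    ∃ v : C.Copies, ∀ i, v.1 (P.colour (C.N i false)) = a i ∧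
      (¬ C.SameColour i → v.1 (P.colour (C.N i true)) = b i) := by
  -- Distinct pairs have disjoint colours, so at a colour of the `i`-th pair only `w i` contributes.
  -- For a shared colour, `b i = 0` keeps the two summands from interfering.
  let w (i : Fin (n - 1)) (c : P.Colour) : ZMod 2 :=
    (if P.colour (C.N i false) = c then a i else 0) + if P.colour (C.N i true) = c then b i else 0
  have hw : ∀ i k, ∑ j, w j (P.colour (C.N i k)) = w i (P.colour (C.N i k)) := by
    intro i k
    refine Finset.sum_eq_single i (fun j _ hj => ?_) (by simp)
    simp only [w]
    rw [if_neg fun h => hj (C.colour_inj _ _ _ _ h), if_neg fun h => hj (C.colour_inj _ _ _ _ h),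
      add_zero]
  refine ⟨⟨fun c => ∑ i, w i c, fun c hc => Finset.sum_eq_zero fun i _ => by simp [w, hc i]⟩,
    fun i => ⟨(hw i false).trans ?_, fun hi => (hw i true).trans ?_⟩⟩
  · by_cases h : C.SameColour i
    · simp [w, hb i h]
    · simp [w, Ne.symm h]
  · simp [w, hi]

theorem angle_surjective :
    Function.Surjective fun k : C.Box × C.Copies => C.angle k.1.1 k.2.1 := by
  intro θ
  choose a b u hu hb hθ using fun i => exists_signed_arc (C.SameColour i) C.width_pos (θ i)
  obtain ⟨v, hv⟩ := C.exists_copy a b hb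
  refine ⟨(⟨u, fun i _ => hu i⟩, v), funext fun i => ?_⟩
  rw [← hθ i]
  change ((signed (v.1 (P.colour (C.N i false))) (arc (C.SameColour i) C.width
    (v.1 (P.colour (C.N i true))) (u i)) : ℝ) :
      AddCircle (2 * halfLength (C.SameColour i) C.width)) = _
  rw [(hv i).1]
  by_cases h : C.SameColour i
  · rw [arc, arc, if_pos (Or.inl h), if_pos (Or.inl h)]
  · rw [(hv i).2 h]

/-- It suffices to precompose with `param`, which turns `coord` into `angle` times the identity of
the ray. Since the box and the finite set of copies are compact, this product is proper, hence
closed. -/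
theorem isQuotientMap_coord : IsQuotientMap C.coord := by
  have hbox : CompactSpace C.Box :=
    isCompact_iff_compactSpace.1 (isCompact_univ_pi fun _ => isCompact_Icc)
  have hcont : Continuous fun k : C.Box × C.Copies => C.angle k.1.1 k.2.1 :=
    C.continuous_angle.comp (f := fun k : C.Box × C.Copies => (k.1.1, k.2.1)) (by fun_prop)
  refine IsQuotientMap.of_comp C.continuous_param C.continuous_coord ?_
  rw [C.coord_param]
  have hp : IsProperMap (Prod.map (fun k : C.Box × C.Copies => C.angle k.1.1 k.2.1)
    (id : Set.Ici (0 : ℝ) → Set.Ici (0 : ℝ))) := hcont.isProperMap.prodMap isProperMap_id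
  exact hp.isClosedMap.isQuotientMap hp.continuous
    (C.angle_surjective.prodMap Function.surjective_id)

/-- Puts the one-circle rules, with equal or different colours, into the form of the gluing
relation: `v` may change at a colour only on a wall of that colour. -/
theorem angle_eq_iff {u u' : Fin (n - 1) → ℝ} (hu : ∀ i, u i ∈ Set.Icc 0 C.width)
    (hu' : ∀ i, u' i ∈ Set.Icc 0 C.width) (v v' : P.Vec) :
    C.angle u v = C.angle u' v' ↔ u = u' ∧ ∀ i b,
      v (P.colour (C.N i b)) ≠ v' (P.colour (C.N i b)) →
        ∃ b', P.colour (C.N i b') = P.colour (C.N i b) ∧ u i = if b' then C.width else 0 := by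
  have key := fun i => signed_arc_coe_eq_iff (C.SameColour i) C.width_pos (hu i) (hu' i)
    (v (P.colour (C.N i false))) (v' (P.colour (C.N i false)))
    (v (P.colour (C.N i true))) (v' (P.colour (C.N i true)))
  constructor
  · intro h
    have h' := fun i => (key i).1 (congrFun h i)
    refine ⟨funext fun i => (h' i).1, fun i b hv => ?_⟩
    by_cases hs : C.SameColour i
    · have hall : ∀ b', P.colour (C.N i b') = P.colour (C.N i false) := by
        intro b'; cases b'
        · rfl
        · exact hs.symm
      rw [hall b] at hv ⊢
      rcases (h' i).2.1 hs hv with h0 | h0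
      · exact ⟨false, rfl, by simpa using h0⟩
      · exact ⟨true, hall true, by simpa using h0⟩
    · refine ⟨b, rfl, ?_⟩
      cases b
      · simpa using ((h' i).2.2 hs).1 hv
      · simpa using ((h' i).2.2 hs).2 hv
  · rintro ⟨rfl, h⟩
    refine funext fun i => (key i).2 ⟨rfl, fun hs hv => ?_, fun hs => ⟨fun hv => ?_, fun hv => ?_⟩⟩
    · obtain ⟨b', -, hb'⟩ := h i false hv
      cases b'
      · exact Or.inl (by simpa using hb')
      · exact Or.inr (by simpa using hb')
    · obtain ⟨b', hc, hb'⟩ := h i false hv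
      cases b'
      · simpa using hb'
      · exact absurd hc.symm hs
    · obtain ⟨b', hc, hb'⟩ := h i true hv
      cases b'
      · exact absurd hc hs
      · simpa using hb'

theorem onFacet_iff (i : Fin (n - 1)) (b : Bool) (x : P.carrier) :
    P.OnFacet x (C.N i b) ↔ C.u i x.1 = if b then C.width else 0 := by
  cases b
  · simpa using C.onFacet_false i x
  · simpa using C.onFacet_true i x

/-- Height and box coordinates determine the point of the polytope, and `angle_eq_iff` matches the
changes of copy, because only incident facets meet the horoball. -/
theorem proj_eq_iff (a b : C.domain) : C.proj a = C.proj b ↔ C.coord a = C.coord b := by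
  have hlog : C.coord a = C.coord b ↔ lor a.1.1.1 C.p = lor b.1.1.1 C.p ∧
      C.angle (fun i => C.u i a.1.1.1) a.1.2 = C.angle (fun i => C.u i b.1.1.1) b.1.2 := by
    have ha := C.lor_p_neg a.1.1.2.1
    have hb := C.lor_p_neg b.1.1.2.1
    rw [Prod.ext_iff, Subtype.ext_iff, and_comm]
    refine and_congr_left fun _ => ?_
    change -Real.log _ = -Real.log _ ↔ _
    rw [neg_inj, Real.log_injOn_pos.eq_iff (neg_pos.2 ha) (neg_pos.2 hb), neg_inj]
  rw [hlog, C.angle_eq_iff (fun i => C.u_mem i _) (fun i => C.u_mem i _), Subtype.ext_iff]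
  refine (tileMk_eq_iff a.1 b.1).trans ?_
  constructor
  · rintro ⟨h1, h2⟩
    refine ⟨by rw [h1], by rw [h1], fun i c hc => ?_⟩
    obtain ⟨F, hF, hx⟩ := h2 _ hc
    obtain ⟨j, b', rfl⟩ := C.incident_of_onFacet a.2.1 hx
    obtain rfl := C.colour_inj _ _ _ _ hF
    exact ⟨b', hF, (C.onFacet_iff j b' _).1 hx⟩
  · rintro ⟨h1, h2, h3⟩
    refine ⟨C.ext_coords h1 (congrFun h2), fun j hj => ?_⟩
    by_cases hinc : ∃ i c, P.colour (C.N i c) = j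
    · obtain ⟨i, c, rfl⟩ := hinc
      obtain ⟨b', hc, hu⟩ := h3 i c hj
      exact ⟨C.N i b', hc, (C.onFacet_iff i b' _).2 hu⟩
    · push Not at hinc
      exact absurd ((a.2.2 j hinc).trans (b.2.2 j hinc).symm) hj

theorem exists_homeomorph : ∃ Φ : C.cusp ≃ₜ C.Torus × Set.Ici (0 : ℝ),
    ∀ a, Φ (C.proj a) = C.coord a :=
  exists_homeomorph_of_isQuotientMap C.isQuotientMap_proj C.isQuotientMap_coord C.proj_eq_iff

theorem isToric : P.IsToric C.p C.cusp := by
  obtain ⟨Φ, hΦ⟩ := C.exists_homeomorph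
  have hdom : ∀ (x : P.carrier) (v : P.Vec), P.toManifold x v ∈ C.cusp → (x, v) ∈ C.domain :=
    fun x v h => C.preimage_cusp.le h
  refine ⟨_, fun i => mul_pos two_pos (halfLength_pos (C.SameColour i) C.width_pos), Φ,
    fun x v h => ?_, fun x x' v h h' => ?_⟩
  · exact congrArg (fun z => (z.2 : ℝ)) (hΦ ⟨(x, v), hdom x v h⟩)
  · rw [C.horosphere_metric]
    refine Finset.sum_congr rfl fun i _ => ?_
    have h1 := congrArg (fun z => z.1 i) (hΦ ⟨(x, v), hdom x v h⟩)
    have h2 := congrArg (fun z => z.1 i) (hΦ ⟨(x', v), hdom x' v h'⟩)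
    refine Eq.trans ?_ (norm_signed_arc_sub (C.SameColour i) C.width_pos (C.u_mem i x)
      (C.u_mem i x') (v (P.colour (C.N i false))) (v (P.colour (C.N i true))))
    exact congrArg₂ (fun y z => ‖y - z‖ ^ 2) h1 h2

theorem isPreconnected_cusp : IsPreconnected C.cusp := by
  obtain ⟨Φ, -⟩ := C.exists_homeomorph
  have hpos : ∀ i, Fact (0 < 2 * halfLength (C.SameColour i) C.width) := fun i =>
    ⟨mul_pos two_pos (halfLength_pos _ C.width_pos)⟩
  have : PreconnectedSpace (Set.Ici (0 : ℝ)) :=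
    isPreconnected_iff_preconnectedSpace.1 (convex_Ici 0).isPreconnected
  have h := isPreconnected_range (continuous_subtype_val.comp Φ.symm.continuous)
  rwa [Set.range_comp, Φ.symm.range_coe, Set.image_univ, Subtype.range_coe] at h

theorem isCuspAbove : P.IsCuspAbove C.p C.cusp := by
  have hsub : C.cusp ⊆ P.aboveHoroball C.p := by
    rintro m ⟨a, ha, rfl⟩
    exact ⟨a.1, a.2, ha.1, rfl⟩
  obtain ⟨m, hm⟩ : C.cusp.Nonempty := by
    obtain ⟨Φ, -⟩ := C.exists_homeomorph
    exact ⟨_, (Φ.symm (0, ⟨0, Set.self_mem_Ici⟩)).2⟩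
  refine ⟨C.isCuspVector, m, hsub hm, Set.Subset.antisymm
    (C.isPreconnected_cusp.subset_connectedComponentIn hm hsub) ?_⟩
  -- The rest of the region above the horoball. It is closed too, since its copies are cut out by a
  -- condition on the discrete part `v`; so the connected set `cusp` is a whole component.
  let Z : Set P.Manifold := tileMk P '' {a | -lor a.1.1 C.p ≤ 1 ∧ a ∉ C.domain}
  have hpre : tileMk P ⁻¹' Z = {a | -lor a.1.1 C.p ≤ 1 ∧ a ∉ C.domain} := by
    ext a
    constructor
    · rintro ⟨b, hb, hab⟩
      have h1 := ((tileMk_eq_iff b a).1 hab).1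
      refine ⟨h1 ▸ hb.1, fun ha => hb.2 ?_⟩
      rw [← C.preimage_cusp] at ha ⊢
      rw [Set.mem_preimage, hab]
      exact ha
    · exact fun ha => ⟨a, ha, rfl⟩
  have hZ : IsClosed Z := by
    rw [← (isQuotientMap_tileMk P).isClosed_preimage, hpre]
    convert C.isClosed_horoball.inter
      (isClosed_vec {v : P.Vec | ¬ ∀ c, (∀ i b, P.colour (C.N i b) ≠ c) → v c = 0}) using 1
    ext a
    exact and_congr_right fun h => not_congr ⟨fun k => k.2, fun k => ⟨h, k⟩⟩
  have hdisj : Disjoint C.cusp Z := by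
    rw [Set.disjoint_left]
    rintro _ h ⟨a, ha, rfl⟩
    exact ha.2 (C.preimage_cusp.le h)
  have hcover : P.aboveHoroball C.p ⊆ C.cusp ∪ Z := by
    rintro m ⟨x, v, hx, rfl⟩
    by_cases h : (x, v) ∈ C.domain
    · exact Or.inl ⟨_, h, rfl⟩
    · exact Or.inr ⟨_, ⟨hx, h⟩, rfl⟩
  rcases isPreconnected_iff_subset_of_disjoint_closed.1
    (isPreconnected_connectedComponentIn (F := P.aboveHoroball C.p) (x := m)) _ _ C.isClosed_cusp hZ
    ((connectedComponentIn_subset _ _).trans hcover)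
    (by rw [hdisj.inter_eq, Set.inter_empty]) with h | h
  · exact h
  · exact absurd (h (mem_connectedComponentIn (hsub hm))) (Set.disjoint_left.1 hdisj hm)

theorem isToricCusp : P.IsToricCusp C.cusp := ⟨C.p, C.isCuspAbove, C.isToric⟩

end CuspChart

/-! ### Diagonal maps on cusps -/

/-- The coordinates of a point of the cube complex in the copies that contain it. -/
def dualCoord {n : ℕ} (P : ColouredPolytope n) : P.CubeComplex → P.Facet → ℝ :=
  Quotient.lift (fun a : P.dualTile × P.Vec => a.1.1) fun _ _ h => congrArg Subtype.val h.1

theorem continuous_dualCoord {n : ℕ} (P : ColouredPolytope n) : Continuous (dualCoord P) :=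
  Continuous.quotient_lift (continuous_subtype_val.comp continuous_fst) _

/-- Two facets with positive coordinates are adjacent, and adjacent facets never share a colour. -/
theorem dualTile_eq_zero {n : ℕ} {P : ColouredPolytope n} (y : P.dualTile) {F F' : P.Facet}
    (hne : F ≠ F') (hF : y.1 F = 1 / 2) (hc : P.colour F = P.colour F') : y.1 F' = 0 := by
  by_contra h
  have hpos : 0 < y.1 F' := lt_of_le_of_ne (y.2.1 F').1 (Ne.symm h)
  obtain ⟨-, x, hx, hx'⟩ := y.2.2 F F' hne (by rw [hF]; norm_num) hpos
  exact P.proper F F' hne ⟨x.1, x.2, hx, hx'⟩ hc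

namespace CuspChart
variable {n : ℕ} {P : ColouredPolytope n} (C : CuspChart P)

/-- Opposite facets of the same colour have the same status. -/
def Balanced (s : P.State) : Prop := ∀ i, C.SameColour i → s (C.N i false) = s (C.N i true)

theorem Balanced.status_eq {C : CuspChart P} {s : P.State} (hs : C.Balanced s) {i j b b'}
    (h : P.colour (C.N i b) = P.colour (C.N j b')) : s (C.N i b) = s (C.N j b') := by
  obtain rfl := C.colour_inj _ _ _ _ h
  cases b <;> cases b'
  · rfl
  · exact hs i h
  · exact (hs i h.symm).symm
  · rfl

open Classical in
/-- The jump of the lift of the diagonal map when a facet of the colour `c` is crossed. -/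
def jump (s : P.State) (c : P.Colour) : ℤ :=
  if ∃ i b, P.colour (C.N i b) = c ∧ s (C.N i b) = .O then 1 else -1

/-- All incident facets of one colour have the same status, so the existential in `jump` can be
tested on any of them. -/
theorem Balanced.jump_eq {C : CuspChart P} {s : P.State} (hs : C.Balanced s) (i b) :
    C.jump s (P.colour (C.N i b)) = if s (C.N i b) = .O then 1 else -1 := by
  unfold jump
  refine if_congr ⟨?_, fun h => ⟨i, b, rfl, h⟩⟩ rfl rfl
  rintro ⟨j, b', hc, h⟩
  rw [← hs.status_eq hc, h]

/-- The contribution of the colour `c` to the lift of the diagonal map. -/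
def liftTerm (s : P.State) (v : P.Vec) (y : P.Facet → ℝ) (c : P.Colour) : ℝ :=
  ∑ F with P.colour F = c, P.sign s v F * y F + C.jump s c * ((if v c = 0 then 0 else 1 : ℤ) : ℝ)

/-- On the wall crossed, `y = 1 / 2` and every other facet of that colour has coordinate `0`. The
sign flip changes the sum by `1` in absolute value, and the jump cancels this change; balance makes
the jump right for both walls of a shared colour. -/
theorem Balanced.liftTerm_eq {C : CuspChart P} {s : P.State} (hs : C.Balanced s)
    (y : P.dualTile) {v w : P.Vec} {c : P.Colour}
    (h : v c ≠ w c → ∃ i b, P.colour (C.N i b) = c ∧ y.1 (C.N i b) = 1 / 2) :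
    C.liftTerm s v y.1 c = C.liftTerm s w y.1 c := by
  by_cases hvw : v c = w c
  · unfold liftTerm
    rw [hvw]
    congr 1
    refine Finset.sum_congr rfl fun F hF => ?_
    rw [ColouredPolytope.sign, ColouredPolytope.sign, (Finset.mem_filter.1 hF).2, hvw]
  · obtain ⟨i, b, rfl, hy⟩ := h hvw
    have hsum : ∀ v : P.Vec, ∑ F with P.colour F = P.colour (C.N i b), P.sign s v F * y.1 F =
        P.sign s v (C.N i b) * (1 / 2) := by
      intro v
      rw [Finset.sum_eq_single_of_mem (C.N i b) (by simp), hy]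
      intro F hF hne
      rw [dualTile_eq_zero y hne.symm hy (Finset.mem_filter.1 hF).2.symm, mul_zero]
    have hdich : ∀ a b : ZMod 2, a ≠ b → (a = 0 ∧ b ≠ 0) ∨ (a ≠ 0 ∧ b = 0) := by decide
    unfold liftTerm
    rw [hsum, hsum, hs.jump_eq, ColouredPolytope.sign, ColouredPolytope.sign]
    rcases hdich _ _ hvw with ⟨h0, h1⟩ | ⟨h0, h1⟩ <;> by_cases hO : s (C.N i b) = .O <;>
      simp [h0, h1, hO] <;> norm_num

/-- The lift of the diagonal map to the copies of the polytope above a cusp. -/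
def lift (s : P.State) (r : C(P.Manifold, P.CubeComplex)) (a : C.domain) : ℝ :=
  ∑ c, C.liftTerm s a.1.2 (dualCoord P (r (C.proj a).1)) c

theorem continuous_liftTerm (s : P.State) (v : P.Vec) (c : P.Colour) :
    Continuous fun y => C.liftTerm s v y c := by
  unfold liftTerm
  fun_prop

theorem continuous_lift (s : P.State) (r : C(P.Manifold, P.CubeComplex)) :
    Continuous (C.lift s r) := by
  have h1 : Continuous fun a : (P.Facet → ℝ) × P.Vec => ∑ c, C.liftTerm s a.2 a.1 c := by
    refine continuous_prod_of_discrete_right.2 fun v => ?_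
    exact continuous_finsetSum _ fun c _ => C.continuous_liftTerm s v c
  have h2 : Continuous fun a : C.domain => dualCoord P (r (C.proj a).1) :=
    (continuous_dualCoord P).comp (r.continuous.comp
      (continuous_subtype_val.comp C.isQuotientMap_proj.continuous))
  have h3 : Continuous fun a : C.domain => a.1.2 := continuous_snd.comp continuous_subtype_val
  have h4 : Continuous fun a : C.domain => (dualCoord P (r (C.proj a).1), a.1.2) := h2.prodMk h3
  have h5 := h1.comp h4
  exact h5

theorem Balanced.lift_eq {C : CuspChart P} {s : P.State} (hs : C.Balanced s)
    {r : C(P.Manifold, P.CubeComplex)} (hr : P.IsCollapse r) {a b : C.domain}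
    (h : C.proj a = C.proj b) : C.lift s r a = C.lift s r b := by
  obtain ⟨y, hy, hF⟩ := hr a.1.1 a.1.2
  have hya : dualCoord P (r (C.proj a).1) = y.1 := congrArg (dualCoord P) hy
  have hv := ((tileMk_eq_iff a.1 b.1).1 (congrArg Subtype.val h)).2
  unfold lift
  rw [← h, hya]
  refine Finset.sum_congr rfl fun c _ => hs.liftTerm_eq y fun hne => ?_
  obtain ⟨F, hc, hx⟩ := hv c hne
  obtain ⟨i, b', rfl⟩ := C.incident_of_onFacet a.2.1 hx
  exact ⟨i, b', hc, hF _ hx⟩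

/-- The jumps are integers, and the remaining terms are the diagonal sum regrouped by colour. -/
theorem coe_lift (s : P.State) {r : C(P.Manifold, P.CubeComplex)} (hr : P.IsCollapse r)
    (a : C.domain) : (C.lift s r a : AddCircle (1 : ℝ)) = P.diagonal s (r (C.proj a).1) := by
  obtain ⟨y, hy, -⟩ := hr a.1.1 a.1.2
  have hya : dualCoord P (r (C.proj a).1) = y.1 := congrArg (dualCoord P) hy
  have hdiag : P.diagonal s (r (C.proj a).1) =
      ((∑ F, P.sign s a.1.2 F * y.1 F : ℝ) : AddCircle (1 : ℝ)) := congrArg (P.diagonal s) hy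
  rw [hdiag, ← sub_eq_zero, ← AddCircle.coe_sub, AddCircle.coe_eq_zero_iff]
  refine ⟨∑ c, C.jump s c * (if a.1.2 c = 0 then 0 else 1 : ℤ), ?_⟩
  unfold lift liftTerm
  rw [hya, Finset.sum_add_distrib, Finset.sum_fiberwise]
  push_cast
  simp

theorem Balanced.nullhomotopic {C : CuspChart P} {s : P.State} (hs : C.Balanced s)
    {f : C(P.Manifold, AddCircle (1 : ℝ))} (hf : P.IsDiagonalMap s f) :
    (f.restrict C.cusp).Nullhomotopic := by
  obtain ⟨r, hr, hfr⟩ := hf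
  let h : C(C.cusp, ℝ) := C.isQuotientMap_proj.lift (f := ⟨C.proj, C.isQuotientMap_proj.continuous⟩)
    ⟨C.lift s r, C.continuous_lift s r⟩ fun a b hab => hs.lift_eq hr hab
  have hh : ∀ a, h (C.proj a) = C.lift s r a := fun a => DFunLike.congr_fun
    (C.isQuotientMap_proj.lift_comp (f := ⟨C.proj, C.isQuotientMap_proj.continuous⟩)
      ⟨C.lift s r, C.continuous_lift s r⟩ fun a b hab => hs.lift_eq hr hab) a
  let e : C(ℝ, AddCircle (1 : ℝ)) := ⟨fun x => x, AddCircle.continuous_mk' 1⟩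
  have heq : ((P.diagonal s).comp r).restrict C.cusp = e.comp h := by
    ext m
    obtain ⟨a, rfl⟩ := C.isQuotientMap_proj.surjective m
    change P.diagonal s (r (C.proj a).1) = ((h (C.proj a) : ℝ) : AddCircle (1 : ℝ))
    rw [hh, C.coe_lift s hr]
  -- The restricted map factors through the contractible space `ℝ`.
  have hnull : (e.comp h).Nullhomotopic :=
    ((id_nullhomotopic ℝ).comp_left h).comp_right e
  obtain ⟨z, hz⟩ := heq ▸ hnull
  exact ⟨z, (hfr.comp (ContinuousMap.Homotopic.refl ⟨_, continuous_subtype_val⟩)).trans hz⟩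

end CuspChart

/-! ### Ideal vertices of the polytopes -/

/-- The ideal vertex between pairs of opposite facets, if the Gram matrix is integral. -/
def chartOfGram {n : ℕ} (P : ColouredPolytope n) (hn : 2 ≤ n) (G : P.Facet → P.Facet → ℤ)
    (N : Fin (n - 1) → Bool → P.Facet)
    (hG : ∀ i b F, lor (P.normal (N i b)) (P.normal F) = G (N i b) F)
    (time : ∀ F, 0 ≤ (P.normal F).2)
    (sum : ∀ i, P.normal (N i false) + P.normal (N i true) =
      P.normal (N ⟨0, by omega⟩ false) + P.normal (N ⟨0, by omega⟩ true))
    (pos : 0 < (P.normal (N ⟨0, by omega⟩ false)).2 + (P.normal (N ⟨0, by omega⟩ true)).2)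
    (opp : G (N ⟨0, by omega⟩ false) (N ⟨0, by omega⟩ true) = -1)
    (orth : ∀ i j, i ≠ j → G (N i false) (N j false) = 0)
    (inc : ∀ i b, G (N ⟨0, by omega⟩ false) (N i b) + G (N ⟨0, by omega⟩ true) (N i b) = 0)
    (far : ∀ F, (∀ i b, F ≠ N i b) →
      G (N ⟨0, by omega⟩ false) F + G (N ⟨0, by omega⟩ true) F ≤ -1)
    (colour_inj : ∀ i j b b', P.colour (N i b) = P.colour (N j b') → i = j) : CuspChart P where
  -- The factor `2` turns the integral bound `≤ -1` for the other facets into the strict bound `<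
  -- -1`, and accounts for the width `1 / 2`.
  p := (2 : ℝ) • (P.normal (N ⟨0, by omega⟩ false) + P.normal (N ⟨0, by omega⟩ true))
  N := N
  width := 1 / 2
  dim := by omega
  null := by
    simp only [lor_smul_left, lor_smul_right, lor_add_left, lor_add_right, P.normal_unit,
      lor_comm (P.normal (N ⟨0, by omega⟩ true)) (P.normal (N ⟨0, by omega⟩ false)), hG _ _, opp]
    norm_num
  pos := mul_pos two_pos pos
  width_pos := by norm_num
  inc i b := by
    rw [lor_smul_left, lor_add_left, hG, hG, ← Int.cast_add, inc]
    simp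
  far F hF := by
    have h : ((_ : ℤ) : ℝ) ≤ ((-1 : ℤ) : ℝ) := Int.cast_le.2 (far F hF)
    rw [lor_smul_left, lor_add_left, hG, hG]
    push_cast at h
    linarith
  time := time
  orth i j h := by rw [hG, orth i j h, Int.cast_zero]
  opp i := by rw [sum i, smul_smul]; norm_num
  colour_inj := colour_inj

theorem add_eq_add_of_int {n : ℕ} {c t : ℝ} {a b a' b' : Fin n → ℤ}
    (h : ∀ k, a k + b k = a' k + b' k) :
    ((fun i => c * (a i : ℝ), t) : Minkowski n) + (fun i => c * (b i : ℝ), t) =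
      (fun i => c * (a' i : ℝ), t) + (fun i => c * (b' i : ℝ), t) := by
  refine Prod.ext (funext fun k => ?_) rfl
  have hk : ((a k + b k : ℤ) : ℝ) = ((a' k + b' k : ℤ) : ℝ) := congrArg _ (h k)
  push_cast at hk
  change c * (a k : ℝ) + c * (b k : ℝ) = c * (a' k : ℝ) + c * (b' k : ℝ)
  rw [← mul_add, hk, mul_add]

/-- An ideal vertex of `P⁵` where opposite facets have distinct colours. -/
def pairs5 (i : Fin 4) (b : Bool) : Facet5 :=
  ⟨fun k => decide (k ≠ 0) && xor b (decide (k = i.succ)), by revert i b; decide⟩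

/-- The Gram matrix of `P⁵`. -/
def gram5 (σ τ : Facet5) : ℤ := (∑ i, sgn (σ.1 i) * sgn (τ.1 i) - 1) / 4

/-- Shows that the integer division in `gram5` is exact on the rows that are used. -/
theorem gram5_mul : ∀ i b (F : Facet5), ∑ k, sgn ((pairs5 i b).1 k) * sgn (F.1 k) =
    4 * gram5 (pairs5 i b) F + 1 := by decide +kernel

theorem lor_pairs5 (i : Fin 4) (b : Bool) (F : Facet5) :
    lor (P5.normal (pairs5 i b)) (P5.normal F) = gram5 (pairs5 i b) F := by
  refine (lor_int _ _ _ _ _).trans ?_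
  rw [gram5_mul]
  push_cast
  ring

theorem pairs5_sum : ∀ i k, sgn ((pairs5 i false).1 k) + sgn ((pairs5 i true).1 k) =
    sgn ((pairs5 0 false).1 k) + sgn ((pairs5 0 true).1 k) := by decide +kernel

theorem pairs5_orth : ∀ i j, i ≠ j → gram5 (pairs5 i false) (pairs5 j false) = 0 := by
  decide +kernel

theorem pairs5_inc : ∀ i b, gram5 (pairs5 0 false) (pairs5 i b) +
    gram5 (pairs5 0 true) (pairs5 i b) = 0 := by decide +kernel

theorem pairs5_far : ∀ F, (∀ i b, F ≠ pairs5 i b) →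
    gram5 (pairs5 0 false) F + gram5 (pairs5 0 true) F ≤ -1 := by decide +kernel

/-- Distinct facets of one colour have opposite first signs, whereas all facets incident to this
vertex have first sign `+`. -/
theorem pairs5_colour : ∀ i j b b',
    P5.colour (pairs5 i b) = P5.colour (pairs5 j b') → i = j ∧ b = b' := by
  unfold P5
  decide +kernel

/-- The chart at an ideal vertex of `P⁵`. -/
def chart5 : CuspChart P5 :=
  chartOfGram P5 (by norm_num) gram5 pairs5 lor_pairs5 (fun F => by change (0 : ℝ) ≤ 1 / 2; norm_num)
    (fun i => add_eq_add_of_int fun k => pairs5_sum i k)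
    (by change (0 : ℝ) < 1 / 2 + 1 / 2; norm_num) (by decide +kernel) pairs5_orth pairs5_inc pairs5_far
    fun i j b b' h => (pairs5_colour i j b b' h).1

/-- The three ideal vertices of `P⁶` with two opposite facets of the first colour. -/
def pairs6 (k : Fin 3) (i : Fin 5) (b : Bool) : Fin 9 × Fin 3 :=
  (![![![(0, 0), (0, 1)], ![(1, 1), (2, 0)], ![(3, 0), (7, 0)], ![(4, 0), (6, 1)], ![(5, 0), (8, 2)]],
    ![![(0, 0), (0, 2)], ![(1, 0), (5, 2)], ![(2, 1), (4, 1)], ![(3, 1), (7, 1)], ![(6, 2), (8, 0)]],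
    ![![(0, 1), (0, 2)], ![(1, 2), (6, 0)], ![(2, 2), (8, 1)], ![(3, 2), (7, 2)],
      ![(4, 2), (5, 1)]]] : Fin 3 → Fin 5 → Fin 2 → Fin 9 × Fin 3) k i (if b then 1 else 0)

/-- The Gram matrix of `P⁶`. -/
def gram6 (F F' : Fin 9 × Fin 3) : ℤ :=
  ∑ i, (vec6 F.1 F.2).1 i * (vec6 F'.1 F'.2).1 i - (vec6 F.1 F.2).2 * (vec6 F'.1 F'.2).2

theorem vec6_time : ∀ c k, 0 ≤ (vec6 c k).2 := by decide +kernel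

theorem pairs6_sum : ∀ k i,
    (∀ j, (vec6 (pairs6 k i false).1 (pairs6 k i false).2).1 j +
      (vec6 (pairs6 k i true).1 (pairs6 k i true).2).1 j =
      (vec6 (pairs6 k 0 false).1 (pairs6 k 0 false).2).1 j +
      (vec6 (pairs6 k 0 true).1 (pairs6 k 0 true).2).1 j) ∧
    (vec6 (pairs6 k i false).1 (pairs6 k i false).2).2 +
      (vec6 (pairs6 k i true).1 (pairs6 k i true).2).2 =
      (vec6 (pairs6 k 0 false).1 (pairs6 k 0 false).2).2 +
      (vec6 (pairs6 k 0 true).1 (pairs6 k 0 true).2).2 := by decide +kernel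

theorem pairs6_pos : ∀ k, 0 < (vec6 (pairs6 k 0 false).1 (pairs6 k 0 false).2).2 +
    (vec6 (pairs6 k 0 true).1 (pairs6 k 0 true).2).2 := by decide +kernel

theorem pairs6_opp : ∀ k, gram6 (pairs6 k 0 false) (pairs6 k 0 true) = -1 := by decide +kernel

theorem pairs6_orth : ∀ k i j, i ≠ j → gram6 (pairs6 k i false) (pairs6 k j false) = 0 := by
  decide +kernel

theorem pairs6_inc : ∀ k i b, gram6 (pairs6 k 0 false) (pairs6 k i b) +
    gram6 (pairs6 k 0 true) (pairs6 k i b) = 0 := by decide +kernel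

theorem pairs6_far : ∀ k F, (∀ i b, F ≠ pairs6 k i b) →
    gram6 (pairs6 k 0 false) F + gram6 (pairs6 k 0 true) F ≤ -1 := by decide +kernel

/-- The pair `i = 0`, taken from the triplet of colour `0`, is the only one with a shared colour, so
balance is a condition on that triplet alone. -/
theorem pairs6_colour : ∀ k i j b b',
    (pairs6 k i b).1 = (pairs6 k j b').1 → i = j ∧ (i ≠ 0 → b = b') := by decide +kernel

/-- The charts at three ideal vertices of `P⁶`. -/
def chart6 (k : Fin 3) : CuspChart P6 :=
  chartOfGram P6 (by norm_num) gram6 (pairs6 k)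
    (fun i b F => by
      change lor (_, _) (_, _) = _
      unfold lor gram6
      push_cast
      rfl)
    (fun F => Int.cast_nonneg (vec6_time F.1 F.2))
    (fun i => by
      refine Prod.ext (funext fun j => ?_) ?_
      · change ((_ : ℤ) : ℝ) + ((_ : ℤ) : ℝ) = ((_ : ℤ) : ℝ) + ((_ : ℤ) : ℝ)
        exact_mod_cast (pairs6_sum k i).1 j
      · change ((_ : ℤ) : ℝ) + ((_ : ℤ) : ℝ) = ((_ : ℤ) : ℝ) + ((_ : ℤ) : ℝ)
        exact_mod_cast (pairs6_sum k i).2)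
    (by
      change 0 < ((_ : ℤ) : ℝ) + ((_ : ℤ) : ℝ)
      exact_mod_cast pairs6_pos k)
    (pairs6_opp k) (pairs6_orth k) (pairs6_inc k) (pairs6_far k)
    fun i j b b' h => (pairs6_colour k i j b b' h).1

/-- An ideal vertex of `P⁷` where opposite facets have distinct colours. -/
def pairs7 (i : Fin 6) (b : Bool) : Facet7 :=
  (![![(0, ![false, false, false]), (1, ![true, false, false])],
    ![(0, ![false, true, false]), (1, ![false, false, false])],
    ![(2, ![false, false, false]), (4, ![false, true, false])],
    ![(2, ![false, false, true]), (4, ![false, false, false])],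
    ![(3, ![false, false, false]), (6, ![true, false, false])],
    ![(3, ![false, false, true]), (6, ![false, false, false])]] : Fin 6 → Fin 2 → Facet7)
    i (if b then 1 else 0)

/-- The Gram matrix of `P⁷`. -/
def gram7 (F F' : Facet7) : ℤ := (∑ i, vec7 F i * vec7 F' i - 1) / 2

theorem gram7_mul : ∀ i b (F : Facet7), ∑ k, vec7 (pairs7 i b) k * vec7 F k =
    2 * gram7 (pairs7 i b) F + 1 := by decide +kernel

theorem lor_pairs7 (i : Fin 6) (b : Bool) (F : Facet7) :
    lor (P7.normal (pairs7 i b)) (P7.normal F) = gram7 (pairs7 i b) F := by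
  refine (lor_int _ _ _ _ _).trans ?_
  rw [gram7_mul, div_pow, div_mul_div_comm, Real.mul_self_sqrt (by norm_num),
    Real.sq_sqrt (by norm_num)]
  push_cast
  ring

theorem pairs7_sum : ∀ i k, vec7 (pairs7 i false) k + vec7 (pairs7 i true) k =
    vec7 (pairs7 0 false) k + vec7 (pairs7 0 true) k := by decide +kernel

theorem pairs7_orth : ∀ i j, i ≠ j → gram7 (pairs7 i false) (pairs7 j false) = 0 := by
  decide +kernel

theorem pairs7_inc : ∀ i b, gram7 (pairs7 0 false) (pairs7 i b) +
    gram7 (pairs7 0 true) (pairs7 i b) = 0 := by decide +kernel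

theorem pairs7_far : ∀ F, (∀ i b, F ≠ pairs7 i b) →
    gram7 (pairs7 0 false) F + gram7 (pairs7 0 true) F ≤ -1 := by decide +kernel

theorem pairs7_colour : ∀ i j b b',
    P7.colour (pairs7 i b) = P7.colour (pairs7 j b') → i = j ∧ b = b' := by
  unfold P7
  decide +kernel

/-- The chart at an ideal vertex of `P⁷`. -/
def chart7 : CuspChart P7 :=
  chartOfGram P7 (by norm_num) gram7 pairs7 lor_pairs7 (fun F => by change 0 ≤ √2 / 2; positivity)
    (fun i => add_eq_add_of_int fun k => pairs7_sum i k)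
    (by change 0 < √2 / 2 + √2 / 2; positivity)
    (by decide +kernel) pairs7_orth pairs7_inc pairs7_far
    fun i j b b' h => (pairs7_colour i j b b' h).1

/-- An ideal vertex of `P⁸` where opposite facets have distinct colours. -/
def pairs8 (i : Fin 7) (b : Bool) : Facet8 :=
  (![![.inl (0, false), .inr (0, false, ![false, false, false, false])],
    ![.inr (1, true, ![false, false, false, false]), .inr (5, true, ![false, false, false, true])],
    ![.inr (1, true, ![false, true, false, false]), .inr (5, true, ![false, false, false, false])],
    ![.inr (2, true, ![false, false, false, false]), .inr (3, true, ![false, true, false, false])],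
    ![.inr (2, true, ![false, false, true, false]), .inr (3, true, ![false, false, false, false])],
    ![.inr (4, true, ![false, false, false, false]), .inr (6, true, ![false, false, true, false])],
    ![.inr (4, true, ![false, false, false, true]),
      .inr (6, true, ![false, false, false, false])]] : Fin 7 → Fin 2 → Facet8)
    i (if b then 1 else 0)

/-- The Gram matrix of `P⁸`. -/
def gram8 (F F' : Facet8) : ℤ := (∑ i, vec8 F i * vec8 F' i - 2) / 2

theorem gram8_mul : ∀ i b (F : Facet8), ∑ k, vec8 (pairs8 i b) k * vec8 F k =
    2 * gram8 (pairs8 i b) F + 2 := by decide +kernel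

theorem lor_pairs8 (i : Fin 7) (b : Bool) (F : Facet8) :
    lor (P8.normal (pairs8 i b)) (P8.normal F) = gram8 (pairs8 i b) F := by
  refine (lor_int _ _ _ _ _).trans ?_
  rw [gram8_mul, div_pow, Real.sq_sqrt (by norm_num)]
  push_cast
  ring

theorem pairs8_sum : ∀ i k, vec8 (pairs8 i false) k + vec8 (pairs8 i true) k =
    vec8 (pairs8 0 false) k + vec8 (pairs8 0 true) k := by decide +kernel

theorem pairs8_orth : ∀ i j, i ≠ j → gram8 (pairs8 i false) (pairs8 j false) = 0 := by
  decide +kernel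

theorem pairs8_inc : ∀ i b, gram8 (pairs8 0 false) (pairs8 i b) +
    gram8 (pairs8 0 true) (pairs8 i b) = 0 := by decide +kernel

/-- The check runs separately over the two summands of `Facet8`, with incidence as a Boolean test;
`pairs8_far` translates it back. -/
theorem pairs8_far_inl : ∀ a, (∀ i b,
    Sum.elim (fun a' => decide (a' = a)) (fun _ => false) (pairs8 i b) = false) →
    gram8 (pairs8 0 false) (.inl a) + gram8 (pairs8 0 true) (.inl a) ≤ -1 := by decide +kernel

theorem pairs8_far_inr : ∀ a, (∀ i b,
    Sum.elim (fun _ => false) (fun a' => decide (a' = a)) (pairs8 i b) = false) →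
    gram8 (pairs8 0 false) (.inr a) + gram8 (pairs8 0 true) (.inr a) ≤ -1 := by decide +kernel

theorem pairs8_far (F : Facet8) (hF : ∀ i b, F ≠ pairs8 i b) :
    gram8 (pairs8 0 false) F + gram8 (pairs8 0 true) F ≤ -1 := by
  rcases F with a | a
  · refine pairs8_far_inl a fun i b => ?_
    have h := hF i b
    rcases hp : pairs8 i b with a' | a'
    · exact decide_eq_false fun hc => h (by rw [hp, hc])
    · rfl
  · refine pairs8_far_inr a fun i b => ?_
    have h := hF i b
    rcases hp : pairs8 i b with a' | a'
    · rfl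
    · exact decide_eq_false fun hc => h (by rw [hp, hc])

theorem pairs8_colour : ∀ i j b b', hextet (pairs8 i b) = hextet (pairs8 j b') → i = j ∧ b = b' := by
  decide +kernel

/-- The chart at an ideal vertex of `P⁸`. -/
def chart8 : CuspChart P8 :=
  chartOfGram P8 (by norm_num) gram8 pairs8 lor_pairs8 (fun F => zero_le_one)
    (fun i => add_eq_add_of_int fun k => pairs8_sum i k)
    (by change (0 : ℝ) < 1 + 1; norm_num)
    (by decide +kernel) pairs8_orth pairs8_inc pairs8_far
    fun i j b b' h => (pairs8_colour i j b b' h).1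

/-! ### Every state is balanced at some vertex. -/

/-- Vacuous: no two opposite facets at this vertex share a colour. -/
theorem balanced5 (s : P5.State) : chart5.Balanced s := fun i h =>
  absurd (pairs5_colour i i false true h).2 (by decide)

theorem balanced7 (s : P7.State) : chart7.Balanced s := fun i h =>
  absurd (pairs7_colour i i false true h).2 (by decide)

theorem balanced8 (s : P8.State) : chart8.Balanced s := fun i h =>
  absurd (pairs8_colour i i false true h).2 (by decide)

theorem exists_balanced6 (s : P6.State) : ∃ k, (chart6 k).Balanced s := by
  have key : ∀ k, s (pairs6 k 0 false) = s (pairs6 k 0 true) → (chart6 k).Balanced s := by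
    intro k hk i h
    by_cases hi : i = 0
    · subst hi
      exact hk
    · exact absurd ((pairs6_colour k i i false true h).2 hi) (by decide)
  -- Pigeonhole: three facets, two statuses. Each of the three coincidences is the balance condition
  -- at one of the three vertices.
  have h : s (0, 0) = s (0, 1) ∨ s (0, 0) = s (0, 2) ∨ s (0, 1) = s (0, 2) := by
    rcases s (0, 0) <;> rcases s (0, 1) <;> rcases s (0, 2) <;> simp
  rcases h with h | h | h
  · exact ⟨0, key 0 h⟩
  · exact ⟨1, key 1 h⟩
  · exact ⟨2, key 2 h⟩

end RightAngled

end

open RightAngled in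
theorem mainTheorem5 :
    (∀ (s : P5.State) (f : C(P5.Manifold, AddCircle (1 : ℝ))), P5.IsDiagonalMap s f →
      ∃ X : Set P5.Manifold, P5.IsToricCusp X ∧ (f.restrict X).Nullhomotopic) ∧
    (∀ (s : P6.State) (f : C(P6.Manifold, AddCircle (1 : ℝ))), P6.IsDiagonalMap s f →
      ∃ X : Set P6.Manifold, P6.IsToricCusp X ∧ (f.restrict X).Nullhomotopic) ∧
    (∀ (s : P7.State) (f : C(P7.Manifold, AddCircle (1 : ℝ))), P7.IsDiagonalMap s f →
      ∃ X : Set P7.Manifold, P7.IsToricCusp X ∧ (f.restrict X).Nullhomotopic) ∧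
    (∀ (s : P8.State) (f : C(P8.Manifold, AddCircle (1 : ℝ))), P8.IsDiagonalMap s f →
      ∃ X : Set P8.Manifold, P8.IsToricCusp X ∧ (f.restrict X).Nullhomotopic) := by
  refine ⟨fun s f hf => ⟨_, chart5.isToricCusp, (balanced5 s).nullhomotopic hf⟩, fun s f hf => ?_,
    fun s f hf => ⟨_, chart7.isToricCusp, (balanced7 s).nullhomotopic hf⟩,
    fun s f hf => ⟨_, chart8.isToricCusp, (balanced8 s).nullhomotopic hf⟩⟩
  obtain ⟨k, hk⟩ := exists_balanced6 s
  exact ⟨_, (chart6 k).isToricCusp, hk.nullhomotopic hf⟩
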